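/- Consider a system $x_{t+1}=Ax_t+Bu_t$, $x_0=0$, $x_t\in\mathbb R^n$, $u_t\in\mathbb R^m$, in canonical form: $\{1,\dots,n\}$ is split into $m$ consecutive blocks of lengths $p_1,\dots,p_m\ge 1$ with last elements $k_1,\dots,k_m$; for $i\notin\mathcal I:=\{k_1,\dots,k_m\}$ the dynamics is the shift $x^i_{t+1}=x^{i+1}_t$; the rows $k_1,\dots,k_m$ of $A$ are arbitrary, and form the matrix $A(\mathcal I,:)$; row $k_i$ of $B$ is the $i$-th unit vector. Let $p=\max_i p_i$. Let $Q,R$ be positive definite, and let $P^e$ be the positive semidefinite solution of the discrete-time algebraic Riccati equation $P=Q+A^\top(P-PB(B^\top PB+R)^{-1}B^\top P)A$. For a horizon $N$ and a reference $(\theta_t)_{t=0}^{N}$ with $\theta_N=0$, the cost is $$J(\mathbf x,\mathbf u)=\sum_{t=0}^{N-1}[f_t(x_t)+g_t(u_t)]+f_N(x_N),$$ with $f_t(x)=\tfrac12(x-\theta_t)^\top Q(x-\theta_t)$ and $g_t(u)=\tfrac12u^\top Ru$ for $t<N$, and $f_N(x)=\tfrac12x^\top P^ex$. Let $J^*$ be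 its infimum over all trajectories from $x_0=0$. With $z_t=(x_t^{k_1},\dots,x_t^{k_m})$, and $z_t=0$ for $t\le0$, each $x_t$ is the concatenation over the blocks $i$ of $(z^i_{t-p_i+1},\dots,z^i_t)$, and $u_t=z_{t+1}-A(\mathcal I,:)x_t$. Let $C(\mathbf z)$ be the cost $J$ as a function of $\mathbf z=(z_1,\dots,z_N)\in\mathbb R^{mN}$. Let $C$ be $\mu_c$-strongly convex and $l_c$-smooth with $0<\mu_c\le l_c$, and put $\zeta=l_c/\mu_c$ (the condition number of $C$) and $\phi=1-1/\sqrt\zeta$. Receding horizon triple momentum (RHTM) with window $W\ge1$ and $K=\lfloor(W-1)/p\rfloor$ runs over $t=1-W,\dots,N-1$; only the stages $1,\dots,N$ carry variables. At time $t$ it 1. initializes $z_{t+W}(0)$ and sets $\omega_{t+W}(-1)=\omega_{t+W}(0)=y_{t+W}(0)=z_{t+W}(0)$; 2. for $j=1,\dots,K$ in this order, with $s=t+W-jp$, computes $$\omega_s(j)=(1+\gamma_\omega)\omega_s(j-1)-\gamma_\omega\omega_s(j-2)-\gamma_c\frac{\partial C}{\partial z_s}(y_{s-p}(j-1),\dots,y_{s+p}(j-1)),$$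 $$y_s(j)=(1+\gamma_y)\omega_s(j)-\gamma_y\omega_s(j-1),\qquad z_s(j)=(1+\gamma_z)\omega_s(j)-\gamma_z\omega_s(j-1);$$ 3. if $t\ge0$, applies $u_t=z_{t+1}(K)-A(\mathcal I,:)x_t$. (The partial gradient depends only on $z_{s-p},\dots,z_{s+p}$ and on the stage costs $f_s,\dots,f_{s+p-1}$, $g_{s-1},\dots,g_{s+p-1}$.) The stepsizes are $\gamma_c=\frac{1+\phi}{l_c}$, $\gamma_\omega=\frac{\phi^2}{2-\phi}$, $\gamma_y=\frac{\phi^2}{(1+\phi)(2-\phi)}$, $\gamma_z=\frac{\phi^2}{1-\phi^2}$. The initialization FOSS (follow the optimal steady state) is $z_{t+1}(0)=(x_t^{e,k_1},\dots,x_t^{e,k_m})$ for $0\le t\le N-1$, where $(x_t^e,u_t^e)$ minimizes $f_t(x)+g_t(u)$ over all $(x,u)$ with $x=Ax+Bu$. Then for every $\bar\theta$ there is a constant $c$, depending only on $A,B,Q,R,\bar\theta$ (not on $N$, $W$, $(\theta_t)$, $\mu_c$, $l_c$), such that whenever $\|\theta_t\|\le\bar\theta$ for all $0\le t\le N$, $$\mathrm{Regret}(\mathrm{RHTM}):=J(\mathrm{RHTM})-J^*\le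 c\,\zeta^2\Big(\frac{\sqrt\zeta-1}{\sqrt\zeta}\Big)^{2K}\sum_{t=0}^{N}\|\theta_t-\theta_{t-1}\|,\qquad \theta_{-1}=0.$$ -/

import Mathlib

open scoped Matrix

noncomputable section

namespace RHTM

/-- Index set of the state coordinates of a canonical-form system with blocks of lengths
`p 1, …, p m`.  The pair `⟨i, r⟩` (with `r` counted from `0`) is the coordinate number
`p 1 + ⋯ + p (i-1) + r + 1` of `ℝⁿ`, where `n = p 1 + ⋯ + p m`. -/
abbrev StateIndex {m : ℕ} (p : Fin m → ℕ+) : Type := (i : Fin m) × Fin (p i : ℕ)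

/-- The state space `ℝⁿ` with its Euclidean norm. -/
abbrev State {m : ℕ} (p : Fin m → ℕ+) : Type := EuclideanSpace ℝ (StateIndex p)

/-- The input space `ℝᵐ` with its Euclidean norm. -/
abbrev Input (m : ℕ) : Type := EuclideanSpace ℝ (Fin m)

/-- The coordinate `k_i`: the last coordinate of block `i`. -/
def lastIndex {m : ℕ} (p : Fin m → ℕ+) (i : Fin m) : StateIndex p :=
  ⟨i, ⟨(p i : ℕ) - 1, Nat.sub_lt (p i).pos Nat.one_pos⟩⟩

/-- `(A, B)` is in canonical form with block lengths `p`: a row of `A` that is not the last one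
of its block is a shift row, the rows `k_i` of `A` are arbitrary, the row `k_i` of `B` is the
`i`-th unit vector, and the other rows of `B` vanish. -/
structure IsCanonicalForm {m : ℕ} (p : Fin m → ℕ+)
    (A : Matrix (StateIndex p) (StateIndex p) ℝ) (B : Matrix (StateIndex p) (Fin m) ℝ) :
    Prop where
  shift : ∀ (i : Fin m) (r : Fin (p i : ℕ)) (h : (r : ℕ) + 1 < (p i : ℕ)) (s : StateIndex p),
    A ⟨i, r⟩ s = if s = ⟨i, ⟨(r : ℕ) + 1, h⟩⟩ then 1 else 0
  input : ∀ (s : StateIndex p) (j : Fin m), B s j = if s = lastIndex p j then 1 else 0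

/-- The controllability index `p = max {p_1, …, p_m}` of a canonical-form system. -/
def controllabilityIndex {m : ℕ} (p : Fin m → ℕ+) : ℕ :=
  Finset.univ.sup fun i => (p i : ℕ)

/-- The entries `x^{k_1}, …, x^{k_m}` of a state `x`. -/
def keyEntries {m : ℕ} (p : Fin m → ℕ+) (x : State p) : Input m :=
  WithLp.toLp 2 fun i => x (lastIndex p i)

/-- The matrix `A(𝓘, :)` formed by the rows `k_1, …, k_m` of `A`. -/
def keyRows {m : ℕ} (p : Fin m → ℕ+) (A : Matrix (StateIndex p) (StateIndex p) ℝ) :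
    Matrix (Fin m) (StateIndex p) ℝ :=
  A.submatrix (lastIndex p) id

/-- The data of a finite-horizon optimal control problem with initial state `0`:
the system `x_{t+1} = A x_t + B u_t`, the horizon `N`, the state costs `f_0, …, f_N` (`f_N` is the
terminal cost) and the input costs `g_0, …, g_{N-1}`. Costs with larger indices are never used. -/
structure Problem {m : ℕ} (p : Fin m → ℕ+) where
  A : Matrix (StateIndex p) (StateIndex p) ℝ
  B : Matrix (StateIndex p) (Fin m) ℝ
  N : ℕ
  f : ℕ → State p → ℝ
  g : ℕ → Input m → ℝ

variable {m : ℕ} {p : Fin m → ℕ+}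

/-! ### Cost, optimal cost and the reformulation in the variables `z` -/

/-- The total cost `J(x, u)`. -/
def Problem.J (S : Problem p) (x : ℕ → State p) (u : ℕ → Input m) : ℝ :=
  (∑ t ∈ Finset.range S.N, (S.f t (x t) + S.g t (u t))) + S.f S.N (x S.N)

/-- `(x, u)` is a trajectory of the system that starts at `x_0 = 0`. -/
def Problem.IsTrajectory (S : Problem p) (x : ℕ → State p) (u : ℕ → Input m) : Prop :=
  x 0 = 0 ∧ ∀ t, x (t + 1) = S.A.toEuclideanLin (x t) + S.B.toEuclideanLin (u t)

/-- The optimal cost in hindsight `J*`. -/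
def Problem.optimalCost (S : Problem p) : ℝ :=
  sInf {c : ℝ | ∃ x u, S.IsTrajectory x u ∧ c = S.J x u}

/-- The state `x_t = (z^1_{t-p_1+1}, …, z^1_t, …, z^m_{t-p_m+1}, …, z^m_t)`. -/
def stateOf (z : ℤ → Input m) (t : ℤ) : State p :=
  WithLp.toLp 2 fun s => z (t - ((p s.1 : ℕ) : ℤ) + 1 + ((s.2 : ℕ) : ℤ)) s.1

/-- The input `u_t = z_{t+1} - A(𝓘, :) x_t`. -/
def Problem.inputOf (S : Problem p) (z : ℤ → Input m) (t : ℤ) : Input m :=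
  z (t + 1) - (keyRows p S.A).toEuclideanLin (stateOf z t)

/-- The cost `f̃_t` as a function of `z`. -/
def Problem.fz (S : Problem p) (t : ℕ) (z : ℤ → Input m) : ℝ := S.f t (stateOf z t)

/-- The cost `g̃_t` as a function of `z`. -/
def Problem.gz (S : Problem p) (t : ℕ) (z : ℤ → Input m) : ℝ := S.g t (S.inputOf z t)

/-- A vector `(z_1, …, z_N) ∈ ℝ^{mN}` as a sequence, with `z_t = 0` for `t ≤ 0`
(the values at `t > N` are never used). -/
def extend (N : ℕ) (z : EuclideanSpace ℝ (Fin N × Fin m)) (t : ℤ) : Input m :=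
  if h : 1 ≤ t ∧ t ≤ (N : ℤ) then
    WithLp.toLp 2 fun i => z (⟨(t - 1).toNat, by omega⟩, i)
  else 0

/-- The objective `C(z)` on `ℝ^{mN}`. -/
def Problem.C (S : Problem p) (z : EuclideanSpace ℝ (Fin S.N × Fin m)) : ℝ :=
  (∑ t ∈ Finset.range (S.N + 1), S.fz t (extend S.N z)) +
    ∑ t ∈ Finset.range S.N, S.gz t (extend S.N z)

/-- `F` is `l`-smooth: differentiable with an `l`-Lipschitz gradient. -/
def IsSmooth {E : Type*} [NormedAddCommGroup E] [InnerProductSpace ℝ E] [CompleteSpace E]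
    (l : ℝ) (F : E → ℝ) : Prop :=
  Differentiable ℝ F ∧ ∀ x y, ‖gradient F x - gradient F y‖ ≤ l * ‖x - y‖

/-- The partial gradient `∂C/∂z_s`, computed from the stage costs `f_s, …, f_{s+p-1}` and
`g_{s-1}, …, g_{s+p-1}` and from `z_{s-p}, …, z_{s+p}` only, where `p` is the controllability
index (costs beyond the horizon do not occur). -/
def Problem.partialC (S : Problem p) (s : ℤ) (z : ℤ → Input m) : Input m :=
  (∑ τ ∈ (Finset.range (S.N + 1)).filter (fun τ : ℕ =>
      s ≤ (τ : ℤ) ∧ (τ : ℤ) ≤ s + (controllabilityIndex p : ℤ) - 1),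
      gradient (fun v : Input m => S.fz τ (Function.update z s v)) (z s)) +
    ∑ τ ∈ (Finset.range S.N).filter (fun τ : ℕ =>
      s - 1 ≤ (τ : ℤ) ∧ (τ : ℤ) ≤ s + (controllabilityIndex p : ℤ) - 1),
      gradient (fun v : Input m => S.gz τ (Function.update z s v)) (z s)

/-! ### Follow the optimal steady state -/

/-- `(x, u)` minimizes `f + g` over the steady states `x = A x + B u`. -/
def Problem.IsOptimalSteadyState (S : Problem p) (t : ℕ) (e : State p × Input m) : Prop :=
  e.1 = S.A.toEuclideanLin e.1 + S.B.toEuclideanLin e.2 ∧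
    ∀ (x : State p) (u : Input m), x = S.A.toEuclideanLin x + S.B.toEuclideanLin u →
      S.f t e.1 + S.g t e.2 ≤ S.f t x + S.g t u

/-- The optimal steady state `(x_t^e, u_t^e)` for the stage cost `f_t(x) + g_t(u)`. -/
def Problem.optimalSteadyState (S : Problem p) (t : ℕ) : State p × Input m :=
  Classical.epsilon (S.IsOptimalSteadyState t)

/-- FOSS: the value given to `z_{t+1}` is `(x_t^{e,k_1}, …, x_t^{e,k_m})`. -/
def Problem.foss (S : Problem p) (t : ℕ) : Input m :=
  keyEntries p (S.optimalSteadyState t).1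

/-! ### Receding horizon triple momentum -/

/-- Stepsizes of triple momentum. -/
structure Stepsizes where
  c : ℝ
  ω : ℝ
  y : ℝ
  z : ℝ

/-- The triple momentum stepsizes for a `μ`-strongly convex and `l`-smooth objective. -/
def tripleMomentumStepsizes (μ l : ℝ) : Stepsizes :=
  let φ : ℝ := 1 - 1 / √(l / μ)
  { c := (1 + φ) / l
    ω := φ ^ 2 / (2 - φ)
    y := φ ^ 2 / ((1 + φ) * (2 - φ))
    z := φ ^ 2 / (1 - φ ^ 2) }

/-- The memory of RHTM: `ω j s`, `y j s`, `z j s` hold `ω_s(j)`, `y_s(j)`, `z_s(j)`. -/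
structure Memory (m : ℕ) where
  ω : ℤ → ℤ → Input m
  y : ℤ → ℤ → Input m
  z : ℤ → ℤ → Input m

/-- Store `v` at position `(j, s)` of an array. -/
def store (a : ℤ → ℤ → Input m) (j s : ℤ) (v : Input m) : ℤ → ℤ → Input m :=
  Function.update a j (Function.update (a j) s v)

/-- Step 1: `ω_s(-1)`, `ω_s(0)`, `y_s(0)`, `z_s(0)` are set to `v`. -/
def Memory.init (M : Memory m) (s : ℤ) (v : Input m) : Memory m where
  ω := store (store M.ω (-1) s v) 0 s v
  y := store M.y 0 s v
  z := store M.z 0 s v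

/-- Step 2: the triple momentum update that computes `ω_s(j)`, `y_s(j)`, `z_s(j)`. -/
def Problem.update (S : Problem p) (γ : Stepsizes) (s j : ℤ) (M : Memory m) : Memory m :=
  let ω' := (1 + γ.ω) • M.ω (j - 1) s - γ.ω • M.ω (j - 2) s - γ.c • S.partialC s (M.y (j - 1))
  { ω := store M.ω j s ω'
    y := store M.y j s ((1 + γ.y) • ω' - γ.y • M.ω (j - 1) s)
    z := store M.z j s ((1 + γ.z) • ω' - γ.z • M.ω (j - 1) s) }

/-- The number `K = ⌊(W - 1) / p⌋` of updates of each variable. -/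
def numUpdates (p : Fin m → ℕ+) (W : ℕ) : ℕ := (W - 1) / controllabilityIndex p

/-- One pass of the main loop, at time `t` with `t + W = i + 1`, interrupted after the updates
`j = 1, …, k`: first `z_{t+W}(0)` is initialized to `φ i` (which may depend on the costs up to
`f_{t+W-1}, g_{t+W-1}`), then the stages `t + W - jp` are updated for `j = 1, …, k` in this order.
Only the stages `1, …, N` carry variables. -/
def Problem.pass (S : Problem p) (γ : Stepsizes) (φ : ℕ → Input m) (i : ℕ) (M : Memory m) :
    ℕ → Memory m
  | 0 => if i + 1 ≤ S.N then M.init ((i : ℤ) + 1) (φ i) else M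
  | k + 1 =>
    let s : ℤ := (i : ℤ) + 1 - ((k : ℤ) + 1) * (controllabilityIndex p : ℤ)
    if 1 ≤ s ∧ s ≤ (S.N : ℤ) then S.update γ s ((k : ℤ) + 1) (S.pass γ φ i M k)
    else S.pass γ φ i M k

/-- The memory after the first `i` passes of the main loop, i.e. after the passes at the times
`1 - W, …, i - W`; it is `0` at the start. In particular `z_s(j) = 0` for `s ≤ 0`. -/
def Problem.memory (S : Problem p) (γ : Stepsizes) (W : ℕ) (φ : ℕ → Input m) :
    ℕ → Memory m
  | 0 => ⟨0, 0, 0⟩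
  | i + 1 => S.pass γ φ i (S.memory γ W φ i) (numUpdates p W)

/-- Step 3: the input `u_t = z_{t+1}(K) - A(𝓘, :) x_t`, computed at time `t` from the memory
at the end of the pass at time `t` and from the observed state `x_t`. -/
def Problem.control (S : Problem p) (γ : Stepsizes) (W : ℕ) (φ : ℕ → Input m) (t : ℕ)
    (x : State p) : Input m :=
  (S.memory γ W φ (t + W)).z (numUpdates p W : ℤ) ((t : ℤ) + 1) -
    (keyRows p S.A).toEuclideanLin x

/-- The states generated by RHTM with initialization `φ`. -/
def Problem.rhtmState (S : Problem p) (γ : Stepsizes) (W : ℕ) (φ : ℕ → Input m) : ℕ → State p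
  | 0 => 0
  | t + 1 => S.A.toEuclideanLin (S.rhtmState γ W φ t) +
      S.B.toEuclideanLin (S.control γ W φ t (S.rhtmState γ W φ t))

/-- The inputs generated by RHTM with initialization `φ`. -/
def Problem.rhtmInput (S : Problem p) (γ : Stepsizes) (W : ℕ) (φ : ℕ → Input m) (t : ℕ) :
    Input m :=
  S.control γ W φ t (S.rhtmState γ W φ t)

/-- The dynamic regret of RHTM with stepsizes `γ`, prediction window `W` and
initialization `φ`. -/
def Problem.regretRHTM (S : Problem p) (γ : Stepsizes) (W : ℕ) (φ : ℕ → Input m) : ℝ :=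
  S.J (S.rhtmState γ W φ) (S.rhtmInput γ W φ) - S.optimalCost

/-! ### Linear quadratic tracking -/

/-- The quadratic form `vᵀ M v`. -/
def quad {ι : Type*} [Fintype ι] (M : Matrix ι ι ℝ) (v : EuclideanSpace ℝ ι) : ℝ :=
  v.ofLp ⬝ᵥ (M *ᵥ v.ofLp)

/-- `P` is the positive semidefinite solution of the discrete-time algebraic Riccati equation
for `A, B, Q, R`. -/
def IsDARESolution {ι κ : Type*} [Fintype ι] [Fintype κ] [DecidableEq κ]
    (A : Matrix ι ι ℝ) (B : Matrix ι κ ℝ) (Q : Matrix ι ι ℝ) (R : Matrix κ κ ℝ)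
    (P : Matrix ι ι ℝ) : Prop :=
  P.PosSemidef ∧ P = Q + Aᵀ * (P - P * B * (Bᵀ * P * B + R)⁻¹ * Bᵀ * P) * A

/-- The tracking problem with stage costs `½ (x - θ_t)ᵀ Q (x - θ_t) + ½ uᵀ R u` for `t < N` and
terminal cost `½ xᵀ P x`. -/
def lqTracking (A : Matrix (StateIndex p) (StateIndex p) ℝ) (B : Matrix (StateIndex p) (Fin m) ℝ)
    (Q : Matrix (StateIndex p) (StateIndex p) ℝ) (R : Matrix (Fin m) (Fin m) ℝ)
    (P : Matrix (StateIndex p) (StateIndex p) ℝ) (N : ℕ) (θ : ℕ → State p) : Problem p where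
  A := A
  B := B
  N := N
  f t x := if t < N then 1 / 2 * quad Q (x - θ t) else 1 / 2 * quad P x
  g _ u := 1 / 2 * quad R u

/-- The total variation `∑_{t=0}^N ‖θ_t - θ_{t-1}‖` with `θ_{-1} = 0`. -/
def pathVariation {E : Type*} [NormedAddCommGroup E] (N : ℕ) (θ : ℕ → E) : ℝ :=
  ∑ t ∈ Finset.range (N + 1), ‖θ t - (if t = 0 then 0 else θ (t - 1))‖

end RHTM

end

open RHTM

/-!
The objective `C` is a quadratic function on `ℝ^{mN}`, and the proof has three ingredients.

*The online scheme is triple momentum.* The partial gradient at stage `s` reads only the stages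
`s - p, …, s + p`. Hence in the pass that initializes stage `i + 1` the `j`-th iterate can be
computed at all stages `s` with `s + j p ≤ i + 1` (`Problem.memory_invariant`), and the input
applied at time `t` is determined by the `K`-th iterate of the offline method (`Problem.memory_z`,
`Problem.rhtm_J_eq_C`).

*Triple momentum converges at the rate `φ = 1 - 1/√ζ`.* Let `S` be the Hessian minus `μ`. Relative
to the minimizer, `(l - μ) ⟪S y, y⟫ - ‖S y‖² + 2 l μ ‖z‖²`, with `y = y(j-1)` and `z = z(j)`,
contracts by `φ²` in each step (`lyapunov_step`). The first step and the comparison of distances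
with values cost a factor `5 ζ²` in total (`momentumZ_suboptimality_le`).

*FOSS is nearly stationary.* The objective is strongly convex with a constant `ν` that depends on
the system only, because `z_{t+1} = u_t + A(𝓘,:) x_t` is controlled by the stage cost at time `t`
(`exists_hessian_coercive`). So the initial regret is at most `‖∇C‖² / (2 ν)` at the initialization.
By shift invariance `∂C/∂z_s` vanishes at the constant sequence of an optimal steady state, and the
optimal steady state is a Lipschitz function of the reference. Therefore `∂C/∂z_s` is bounded by
the variation of the reference within distance `p` of `s`, also near both ends, where the
reference is `0` outside the horizon (`exists_norm_partialC_foss_le`). Summing the squares over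
`s`, and bounding one factor of each square by `2 θbar`, gives the path variation
(`sum_windowVariation_sq_le`). Of the terminal cost only its positive semidefiniteness enters.
-/

open scoped InnerProductSpace

noncomputable section

namespace RHTM

/-! ### Quadratic functions on an inner product space -/

section Quadratic

variable {E V : Type*} [NormedAddCommGroup E] [InnerProductSpace ℝ E]
  [NormedAddCommGroup V] [InnerProductSpace ℝ V]

/-- `F` is a quadratic function with gradient field `G` and (constant) Hessian `T`, expressed by
its exact second-order expansion rather than by derivatives. -/
structure IsQuadratic (F : E → ℝ) (G : E → E) (T : E →ₗ[ℝ] E) : Prop where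
  symm : T.IsSymmetric
  grad_add : ∀ z w, G (z + w) = G z + T w
  expand : ∀ z w, F (z + w) = F z + ⟪G z, w⟫_ℝ + 1 / 2 * ⟪T w, w⟫_ℝ

theorem IsQuadratic.add {F₁ F₂ : E → ℝ} {G₁ G₂ : E → E} {T₁ T₂ : E →ₗ[ℝ] E}
    (h₁ : IsQuadratic F₁ G₁ T₁) (h₂ : IsQuadratic F₂ G₂ T₂) :
    IsQuadratic (fun z => F₁ z + F₂ z) (fun z => G₁ z + G₂ z) (T₁ + T₂) where
  symm := h₁.symm.add h₂.symm
  grad_add z w := by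
    simp only [h₁.grad_add, h₂.grad_add, LinearMap.add_apply]; abel
  expand z w := by
    simp only [h₁.expand, h₂.expand, LinearMap.add_apply, inner_add_left]; ring

theorem IsQuadratic.sum {ι : Type*} (I : Finset ι) {F : ι → E → ℝ} {G : ι → E → E}
    {T : ι → E →ₗ[ℝ] E} (h : ∀ i ∈ I, IsQuadratic (F i) (G i) (T i)) :
    IsQuadratic (fun z => ∑ i ∈ I, F i z) (fun z => ∑ i ∈ I, G i z) (∑ i ∈ I, T i) := by
  classical
  induction I using Finset.induction_on with
  | empty => exact ⟨by intro x y; simp, by simp, by simp⟩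
  | insert a I ha ih =>
    simp only [Finset.sum_insert ha]
    exact (h a (Finset.mem_insert_self a I)).add
      (ih fun i hi => h i (Finset.mem_insert_of_mem hi))

theorem IsQuadratic.congr {F F' : E → ℝ} {G : E → E} {T : E →ₗ[ℝ] E} (h : IsQuadratic F G T)
    (hF : ∀ z, F' z = F z) : IsQuadratic F' G T :=
  (funext hF : F' = F) ▸ h

theorem isQuadratic_comp [FiniteDimensional ℝ E] [FiniteDimensional ℝ V]
    {M : V →ₗ[ℝ] V} (hM : M.IsSymmetric) (L : E →ₗ[ℝ] V) (b : V) :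
    IsQuadratic (fun z => 1 / 2 * ⟪M (L z - b), L z - b⟫_ℝ)
      (fun z => LinearMap.adjoint L (M (L z - b))) (LinearMap.adjoint L ∘ₗ M ∘ₗ L) where
  symm x y := by
    simp [LinearMap.adjoint_inner_left, LinearMap.adjoint_inner_right, hM (L x) (L y)]
  grad_add z w := by
    simp only [map_add, map_sub, LinearMap.comp_apply]; abel
  expand z w := by
    have h := hM (L z - b) (L w)
    rw [real_inner_comm] at h
    simp only [LinearMap.comp_apply, LinearMap.adjoint_inner_left]
    rw [show L (z + w) - b = (L z - b) + L w by rw [map_add]; abel]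
    rw [map_add, inner_add_left, inner_add_right, inner_add_right,
      real_inner_comm (L z - b) (M (L w)), real_inner_comm (L w) (M (L z - b))]
    rw [← h]
    ring

variable {F : E → ℝ} {G : E → E} {T : E →ₗ[ℝ] E}

theorem IsQuadratic.grad_sub (h : IsQuadratic F G T) (x y : E) : G x - G y = T (x - y) := by
  have := h.grad_add y (x - y)
  rw [add_sub_cancel] at this
  rw [this]; abel

theorem IsQuadratic.hasGradientAt [FiniteDimensional ℝ E] (h : IsQuadratic F G T) (z : E) :
    HasGradientAt F (G z) z := by
  rw [hasGradientAt_iff_hasFDerivAt, hasFDerivAt_iff_isLittleO_nhds_zero]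
  have hT := T.toContinuousLinearMap.le_opNorm
  have key : (fun w : E => F (z + w) - F z - (InnerProductSpace.toDual ℝ E (G z)) w)
      = fun w => 1 / 2 * ⟪T w, w⟫_ℝ := by
    funext w
    rw [h.expand, InnerProductSpace.toDual_apply_apply]; ring
  rw [key]
  refine Asymptotics.IsBigO.trans_isLittleO (g := fun w : E => ‖w‖ ^ 2) ?_ ?_
  · refine Asymptotics.IsBigO.of_bound (1 / 2 * ‖T.toContinuousLinearMap‖) ?_
    refine Filter.Eventually.of_forall fun w => ?_
    have h1 : |⟪T w, w⟫_ℝ| ≤ ‖T w‖ * ‖w‖ := abs_real_inner_le_norm _ _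
    have h2 : ‖T w‖ ≤ ‖T.toContinuousLinearMap‖ * ‖w‖ := hT w
    have h3 : ‖T w‖ * ‖w‖ ≤ ‖T.toContinuousLinearMap‖ * ‖w‖ * ‖w‖ :=
      mul_le_mul_of_nonneg_right h2 (norm_nonneg _)
    rw [Real.norm_eq_abs, abs_mul, Real.norm_eq_abs, abs_of_nonneg (sq_nonneg ‖w‖),
      abs_of_pos (by norm_num : (0 : ℝ) < 1 / 2)]
    nlinarith
  · have := Asymptotics.isLittleO_norm_pow_id (E' := E) (n := 2) (by norm_num)
    simpa using this

theorem IsQuadratic.le_inner_of_strongConvexOn (h : IsQuadratic F G T) {μ : ℝ}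
    (hF : StrongConvexOn Set.univ μ F) (w : E) : μ * ‖w‖ ^ 2 ≤ ⟪T w, w⟫_ℝ := by
  -- the midpoint inequality between `w` and `-w`
  obtain ⟨-, hF⟩ := hF
  have h1 := hF (Set.mem_univ (0 + w)) (Set.mem_univ (0 + -w))
    (a := 1 / 2) (b := 1 / 2) (by norm_num) (by norm_num) (by norm_num)
  have h2 : (1 / 2 : ℝ) • ((0 : E) + w) + (1 / 2 : ℝ) • (0 + -w) = 0 := by
    simp
  have h3 : (0 : E) + w - (0 + -w) = (2 : ℝ) • w := by rw [two_smul]; abel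
  rw [h2, h3, norm_smul, h.expand, h.expand] at h1
  simp only [inner_neg_right, map_neg, inner_neg_left, neg_neg, smul_eq_mul, Real.norm_ofNat] at h1
  nlinarith

theorem IsQuadratic.norm_le_of_isSmooth [FiniteDimensional ℝ E] (h : IsQuadratic F G T) {l : ℝ}
    (hF : IsSmooth l F) (w : E) : ‖T w‖ ≤ l * ‖w‖ := by
  have := hF.2 w 0
  rw [(h.hasGradientAt w).gradient, (h.hasGradientAt 0).gradient, h.grad_sub, sub_zero] at this
  exact this

theorem IsQuadratic.exists_grad_eq_zero [FiniteDimensional ℝ E] (h : IsQuadratic F G T) {μ : ℝ}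
    (hμ : 0 < μ) (hT : ∀ w, μ * ‖w‖ ^ 2 ≤ ⟪T w, w⟫_ℝ) : ∃ z, G z = 0 := by
  have hinj : Function.Injective T := by
    rw [← LinearMap.ker_eq_bot, LinearMap.ker_eq_bot']
    intro w hw
    have := hT w
    rw [hw, inner_zero_left] at this
    have h0 : ‖w‖ ^ 2 ≤ 0 := by nlinarith [sq_nonneg ‖w‖]
    exact norm_eq_zero.1 (pow_eq_zero_iff (two_ne_zero) |>.1 (le_antisymm h0 (sq_nonneg _)))
  obtain ⟨w, hw⟩ := (LinearMap.injective_iff_surjective.1 hinj) (-G 0)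
  refine ⟨0 + w, ?_⟩
  rw [h.grad_add, hw]; abel

theorem IsQuadratic.eq_of_grad_eq_zero (h : IsQuadratic F G T) {x : E} (hx : G x = 0) (z : E) :
    F z = F x + 1 / 2 * ⟪T (z - x), z - x⟫_ℝ := by
  have := h.expand x (z - x)
  rw [hx, inner_zero_left, add_sub_cancel] at this
  linarith

theorem IsQuadratic.le_of_grad_eq_zero (h : IsQuadratic F G T) {μ : ℝ}
    (hμ : 0 < μ) (hT : ∀ w, μ * ‖w‖ ^ 2 ≤ ⟪T w, w⟫_ℝ) {x : E} (hx : G x = 0) (z : E) :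
    F x ≤ F z := by
  have h1 := h.eq_of_grad_eq_zero hx z
  have h2 := hT (z - x)
  have h3 : 0 ≤ μ * ‖z - x‖ ^ 2 := by positivity
  linarith

/-- The Polyak–Łojasiewicz inequality. -/
theorem IsQuadratic.sub_le_norm_grad_sq (h : IsQuadratic F G T) {μ : ℝ}
    (hμ : 0 < μ) (hT : ∀ w, μ * ‖w‖ ^ 2 ≤ ⟪T w, w⟫_ℝ) (z x : E) :
    F z - F x ≤ ‖G z‖ ^ 2 / (2 * μ) := by
  have h1 := h.expand z (x - z)
  rw [add_sub_cancel] at h1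
  have h2 := hT (x - z)
  have h3 : -(‖G z‖ * ‖x - z‖) ≤ ⟪G z, x - z⟫_ℝ :=
    neg_le_of_abs_le (abs_real_inner_le_norm _ _)
  rw [le_div_iff₀ (by positivity)]
  nlinarith [sq_nonneg (‖G z‖ - μ * ‖x - z‖)]

/-- Cocoercivity of a positive symmetric operator bounded by `κ`. -/
theorem norm_sq_le_mul_inner {S : E →ₗ[ℝ] E} (hS : S.IsSymmetric) {κ : ℝ} (hκ : 0 ≤ κ)
    (h0 : ∀ w, 0 ≤ ⟪S w, w⟫_ℝ) (h1 : ∀ w, ⟪S w, w⟫_ℝ ≤ κ * ‖w‖ ^ 2) (w : E) :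
    ‖S w‖ ^ 2 ≤ κ * ⟪S w, w⟫_ℝ := by
  have key : ∀ t : ℝ,
      0 ≤ ⟪S w, w⟫_ℝ - 2 * t * ‖S w‖ ^ 2 + t ^ 2 * (κ * ‖S w‖ ^ 2) := by
    intro t
    have h2 := h0 (w - t • S w)
    have h3 := h1 (S w)
    have h4 : ⟪S (S w), w⟫_ℝ = ‖S w‖ ^ 2 := by
      rw [hS (S w) w, real_inner_self_eq_norm_sq]
    simp only [map_sub, map_smul, inner_sub_left, inner_sub_right, inner_smul_left,
      inner_smul_right, real_inner_self_eq_norm_sq, h4] at h2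
    simp only [conj_trivial] at h2
    nlinarith [sq_nonneg t]
  rcases hκ.eq_or_lt with rfl | hκ
  · have h2 := key 1
    have h3 := h1 w
    linarith
  · have h2 := key (1 / κ)
    have : ⟪S w, w⟫_ℝ - 2 * (1 / κ) * ‖S w‖ ^ 2 + (1 / κ) ^ 2 * (κ * ‖S w‖ ^ 2)
        = (κ * ⟪S w, w⟫_ℝ - ‖S w‖ ^ 2) / κ := by field_simp; ring
    rw [this] at h2
    have h3 := mul_nonneg h2 hκ.le
    rw [div_mul_cancel₀ _ hκ.ne'] at h3
    linarith

end Quadratic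

/-! ### Triple momentum -/

section TripleMomentum

variable {E : Type*} [AddCommGroup E] [Module ℝ E]

/-- The pairs `(ω(j), ω(j-1))` of the triple momentum method with gradient field `G`, started at
`ω(0) = ω(-1) = z₀`. The gradient is evaluated at `y(j) = (1 + γ_y) ω(j) - γ_y ω(j-1)`. -/
def momentum (γ : Stepsizes) (G : E → E) (z₀ : E) : ℕ → E × E
  | 0 => (z₀, z₀)
  | j + 1 =>
    let q := momentum γ G z₀ j
    ((1 + γ.ω) • q.1 - γ.ω • q.2 - γ.c • G ((1 + γ.y) • q.1 - γ.y • q.2), q.1)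

/-- The extrapolated gradient point `y(j)`. -/
def momentumY (γ : Stepsizes) (G : E → E) (z₀ : E) (j : ℕ) : E :=
  (1 + γ.y) • (momentum γ G z₀ j).1 - γ.y • (momentum γ G z₀ j).2

/-- The output `z(j)`. -/
def momentumZ (γ : Stepsizes) (G : E → E) (z₀ : E) (j : ℕ) : E :=
  (1 + γ.z) • (momentum γ G z₀ j).1 - γ.z • (momentum γ G z₀ j).2

theorem momentum_map {E' : Type*} [AddCommGroup E'] [Module ℝ E'] (γ : Stepsizes)
    {G : E → E} {G' : E' → E'} (L : E →ₗ[ℝ] E') (h : ∀ z, L (G z) = G' (L z)) (z₀ : E) (j : ℕ) :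
    momentum γ G' (L z₀) j = (L (momentum γ G z₀ j).1, L (momentum γ G z₀ j).2) := by
  induction j with
  | zero => rfl
  | succ j ih => simp [momentum, ih, h]

theorem momentumZ_map {E' : Type*} [AddCommGroup E'] [Module ℝ E'] (γ : Stepsizes)
    {G : E → E} {G' : E' → E'} (L : E →ₗ[ℝ] E') (h : ∀ z, L (G z) = G' (L z)) (z₀ : E) (j : ℕ) :
    momentumZ γ G' (L z₀) j = L (momentumZ γ G z₀ j) := by
  simp [momentumZ, momentum_map γ L h]

end TripleMomentum

section Lyapunov

variable {E : Type*} [NormedAddCommGroup E] [InnerProductSpace ℝ E]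

/-- The stepsizes of triple momentum in terms of the rate `ρ = 1 - 1 / √(l / μ)`. -/
theorem tripleMomentumStepsizes_eq (μ l : ℝ) {ρ : ℝ} (hρ : ρ = 1 - 1 / √(l / μ)) :
    tripleMomentumStepsizes μ l = ⟨(1 + ρ) / l, ρ ^ 2 / (2 - ρ), ρ ^ 2 / ((1 + ρ) * (2 - ρ)),
      ρ ^ 2 / (1 - ρ ^ 2)⟩ := by
  subst hρ; rfl

/-- In the variables `z(j)`, `y(j)` triple momentum is an exponential average. -/
theorem momentumZ_succ {l ρ : ℝ} (hl : 0 < l) (h0 : 0 ≤ ρ) (h1 : ρ < 1) (G : E → E) (z₀ : E)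
    (γ : Stepsizes) (hγ : γ = ⟨(1 + ρ) / l, ρ ^ 2 / (2 - ρ), ρ ^ 2 / ((1 + ρ) * (2 - ρ)),
      ρ ^ 2 / (1 - ρ ^ 2)⟩) (j : ℕ) :
    momentumZ γ G z₀ (j + 1) = ρ • momentumZ γ G z₀ j + (1 - ρ) • momentumY γ G z₀ j
      - (1 / (l * (1 - ρ))) • G (momentumY γ G z₀ j) := by
  have e1 : 2 - ρ ≠ 0 := by linarith
  have e2 : 1 + ρ ≠ 0 := by linarith
  have e3 : 1 - ρ ≠ 0 := by linarith
  have e4 : 1 - ρ ^ 2 = (1 + ρ) * (1 - ρ) := by ring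
  simp only [momentumZ, momentum]
  rw [← momentumY]
  generalize G (momentumY γ G z₀ j) = g
  simp only [momentumY, hγ, e4]
  match_scalars <;> field_simp <;> ring

theorem momentumY_succ {l ρ : ℝ} (hl : 0 < l) (h0 : 0 ≤ ρ) (h1 : ρ < 1) (G : E → E) (z₀ : E)
    (γ : Stepsizes) (hγ : γ = ⟨(1 + ρ) / l, ρ ^ 2 / (2 - ρ), ρ ^ 2 / ((1 + ρ) * (2 - ρ)),
      ρ ^ 2 / (1 - ρ ^ 2)⟩) (j : ℕ) :
    momentumY γ G z₀ (j + 1) =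
      (ρ / (2 - ρ)) • (momentumY γ G z₀ j - (1 / l) • G (momentumY γ G z₀ j))
      + (2 * (1 - ρ) / (2 - ρ)) • momentumZ γ G z₀ (j + 1) := by
  have e1 : 2 - ρ ≠ 0 := by linarith
  have e2 : 1 + ρ ≠ 0 := by linarith
  have e3 : 1 - ρ ≠ 0 := by linarith
  have e4 : 1 - ρ ^ 2 = (1 + ρ) * (1 - ρ) := by ring
  simp only [momentumZ]
  rw [show momentumY γ G z₀ (j + 1) = (1 + γ.y) • (momentum γ G z₀ (j + 1)).1
    - γ.y • (momentum γ G z₀ (j + 1)).2 from rfl]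
  simp only [momentum]
  rw [← momentumY]
  generalize G (momentumY γ G z₀ j) = g
  simp only [momentumY, hγ, e4]
  match_scalars <;> field_simp <;> ring

/-- One step of the Lyapunov inequality: with `q(y) = κ ⟪S y, y⟫ - ‖S y‖²`, where
`κ = l - μ` and `S` is the Hessian minus `μ = l (1 - ρ)²`, the quantity
`q(y(j-1)) + 2 l μ ‖z(j) - z*‖²` contracts by `ρ²`. The vectors are relative to `z*`. -/
theorem lyapunov_step {S : E →ₗ[ℝ] E} (hS : S.IsSymmetric) {l μ ρ : ℝ} (hl : 0 < l)
    (h0 : 0 ≤ ρ) (h1 : ρ < 1) (hμ : μ = l * (1 - ρ) ^ 2)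
    (hq : ∀ y, 0 ≤ (l - μ) * ⟪S y, y⟫_ℝ - ‖S y‖ ^ 2)
    {y y' z z' : E}
    (hy : y' = (ρ / (2 - ρ)) • (y - (1 / l) • (S y + μ • y)) + (2 * (1 - ρ) / (2 - ρ)) • z)
    (hz : z' = ρ • z - (1 / (l * (1 - ρ))) • S y') :
    (l - μ) * ⟪S y', y'⟫_ℝ - ‖S y'‖ ^ 2 + 2 * l * μ * ‖z'‖ ^ 2
      ≤ ρ ^ 2 * ((l - μ) * ⟪S y, y⟫_ℝ - ‖S y‖ ^ 2 + 2 * l * μ * ‖z‖ ^ 2) := by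
  have e1 : 2 - ρ ≠ 0 := by linarith
  have e3 : 1 - ρ ≠ 0 := by linarith
  have hq1 := hq (y' - y)
  have hq2 := hq y'
  have hsy : ⟪S y', y⟫_ℝ = ⟪S y, y'⟫_ℝ := by rw [hS y' y, real_inner_comm]
  have hz2 : ‖z'‖ ^ 2 = ρ ^ 2 * ‖z‖ ^ 2 - 2 * ρ * (1 / (l * (1 - ρ))) * ⟪S y', z⟫_ℝ
      + (1 / (l * (1 - ρ))) ^ 2 * ‖S y'‖ ^ 2 := by
    rw [hz, ← real_inner_self_eq_norm_sq, ← real_inner_self_eq_norm_sq z,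
      ← real_inner_self_eq_norm_sq (S y')]
    simp only [inner_sub_left, inner_sub_right, inner_smul_left, inner_smul_right, conj_trivial]
    rw [real_inner_comm z (S y')]
    ring
  have hy2 : ⟪S y', y'⟫_ℝ = (ρ / (2 - ρ)) * (⟪S y', y⟫_ℝ - (1 / l) * (⟪S y', S y⟫_ℝ
      + μ * ⟪S y', y⟫_ℝ)) + (2 * (1 - ρ) / (2 - ρ)) * ⟪S y', z⟫_ℝ := by
    generalize S y' = s
    simp only [hy, inner_add_right, inner_sub_right, inner_smul_right]
  have hq3 : ‖S (y' - y)‖ ^ 2 = ‖S y'‖ ^ 2 - 2 * ⟪S y', S y⟫_ℝ + ‖S y‖ ^ 2 := by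
    rw [map_sub, norm_sub_sq_real]
  have hq4 : ⟪S (y' - y), y' - y⟫_ℝ = ⟪S y', y'⟫_ℝ - 2 * ⟪S y', y⟫_ℝ + ⟪S y, y⟫_ℝ := by
    rw [map_sub, inner_sub_left, inner_sub_right, inner_sub_right, ← hsy]; ring
  rw [hq3, hq4] at hq1
  rw [hz2]
  -- the difference of the two sides is `ρ² q(y' - y) + (1 - ρ²) q(y')`
  have key : ρ ^ 2 * ((l - μ) * ⟪S y, y⟫_ℝ - ‖S y‖ ^ 2 + 2 * l * μ * ‖z‖ ^ 2)
      - ((l - μ) * ⟪S y', y'⟫_ℝ - ‖S y'‖ ^ 2 + 2 * l * μ * (ρ ^ 2 * ‖z‖ ^ 2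
        - 2 * ρ * (1 / (l * (1 - ρ))) * ⟪S y', z⟫_ℝ + (1 / (l * (1 - ρ))) ^ 2 * ‖S y'‖ ^ 2))
      = ρ ^ 2 * ((l - μ) * (⟪S y', y'⟫_ℝ - 2 * ⟪S y', y⟫_ℝ + ⟪S y, y⟫_ℝ)
        - (‖S y'‖ ^ 2 - 2 * ⟪S y', S y⟫_ℝ + ‖S y‖ ^ 2))
        + (1 - ρ ^ 2) * ((l - μ) * ⟪S y', y'⟫_ℝ - ‖S y'‖ ^ 2) := by
    generalize ⟪S y', y'⟫_ℝ = a at *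
    subst hy2
    subst hμ
    field_simp
    ring
  have h2 : 0 ≤ 1 - ρ ^ 2 := by nlinarith
  nlinarith [mul_nonneg (sq_nonneg ρ) hq1, mul_nonneg h2 hq2]

/-- Convergence of triple momentum on a quadratic function at the rate `ρ = 1 - 1 / √(l / μ)`. -/
theorem norm_momentumZ_sub_sq_le {F : E → ℝ} {G : E → E} {T : E →ₗ[ℝ] E}
    (hF : IsQuadratic F G T) {μ l : ℝ} (hμ : 0 < μ) (hμl : μ ≤ l)
    (hT : ∀ w, μ * ‖w‖ ^ 2 ≤ ⟪T w, w⟫_ℝ) (hT' : ∀ w, ‖T w‖ ≤ l * ‖w‖)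
    {x : E} (hx : G x = 0) (z₀ : E) (K : ℕ) :
    ‖momentumZ (tripleMomentumStepsizes μ l) G z₀ K - x‖ ^ 2
      ≤ 5 * (l / μ) * (1 - 1 / √(l / μ)) ^ (2 * K) * ‖z₀ - x‖ ^ 2 := by
  have hl : 0 < l := hμ.trans_le hμl
  have hζ : 1 ≤ l / μ := by rwa [one_le_div hμ]
  have hs1 : 1 ≤ √(l / μ) := Real.one_le_sqrt.2 hζ
  have hs2 : √(l / μ) ^ 2 = l / μ := Real.sq_sqrt (by linarith)
  obtain ⟨ρ, hρ⟩ : ∃ ρ, ρ = 1 - 1 / √(l / μ) := ⟨_, rfl⟩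
  have hγ := tripleMomentumStepsizes_eq μ l hρ
  rw [← hρ]
  have h0 : 0 ≤ ρ := by
    rw [hρ, sub_nonneg, div_le_one (by linarith)]; exact hs1
  have h1 : ρ < 1 := by
    rw [hρ, sub_lt_self_iff]; positivity
  have hμρ : μ = l * (1 - ρ) ^ 2 := by
    rw [hρ, sub_sub_cancel, div_pow, hs2]; field_simp
  generalize tripleMomentumStepsizes μ l = γ at *
  have e3 : 1 - ρ ≠ 0 := by linarith
  -- the Hessian minus its lower bound
  obtain ⟨S, hSdef⟩ : ∃ S : E →ₗ[ℝ] E, ∀ w, S w = T w - μ • w :=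
    ⟨T - μ • LinearMap.id, fun w => by simp⟩
  have hS : S.IsSymmetric := by
    intro a b
    rw [hSdef, hSdef, inner_sub_left, inner_sub_right, hF.symm a b, inner_smul_left,
      inner_smul_right, conj_trivial]
  have hS0 : ∀ w, 0 ≤ ⟪S w, w⟫_ℝ := by
    intro w
    rw [hSdef, inner_sub_left, inner_smul_left, real_inner_self_eq_norm_sq, conj_trivial]
    linarith [hT w]
  have hS1 : ∀ w, ⟪S w, w⟫_ℝ ≤ (l - μ) * ‖w‖ ^ 2 := by
    intro w
    rw [hSdef, inner_sub_left, inner_smul_left, real_inner_self_eq_norm_sq, conj_trivial]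
    have h2 : ⟪T w, w⟫_ℝ ≤ ‖T w‖ * ‖w‖ := real_inner_le_norm _ _
    have h3 := mul_le_mul_of_nonneg_right (hT' w) (norm_nonneg w)
    nlinarith
  have hq : ∀ y, 0 ≤ (l - μ) * ⟪S y, y⟫_ℝ - ‖S y‖ ^ 2 := fun y =>
    sub_nonneg.2 (norm_sq_le_mul_inner hS (by linarith) hS0 hS1 y)
  have hG : ∀ z, G z = S (z - x) + μ • (z - x) := by
    intro z
    have := hF.grad_sub z x
    rw [hx, sub_zero] at this
    rw [this, hSdef]; abel
  set Y := fun j => momentumY γ G z₀ j - x with hY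
  set Z := fun j => momentumZ γ G z₀ j - x with hZ
  have hZs : ∀ j, Z (j + 1) = ρ • Z j - (1 / (l * (1 - ρ))) • S (Y j) := by
    intro j
    simp only [hZ, hY]
    rw [momentumZ_succ hl h0 h1 G z₀ γ hγ, hG, hμρ]
    generalize S (momentumY γ G z₀ j - x) = s
    match_scalars <;> field_simp <;> ring
  have hYs : ∀ j, Y (j + 1) = (ρ / (2 - ρ)) • (Y j - (1 / l) • (S (Y j) + μ • Y j))
      + (2 * (1 - ρ) / (2 - ρ)) • Z (j + 1) := by
    intro j
    have e1 : 2 - ρ ≠ 0 := by linarith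
    simp only [hZ, hY]
    rw [momentumY_succ hl h0 h1 G z₀ γ hγ, hG]
    generalize S (momentumY γ G z₀ j - x) = s
    match_scalars <;> field_simp
    ring
  have hZ0 : Z 0 = z₀ - x := by
    simp only [hZ, momentumZ, momentum, add_smul, one_smul]; abel
  have hY0 : Y 0 = z₀ - x := by
    simp only [hY, momentumY, momentum, add_smul, one_smul]; abel
  have hV : ∀ j, (l - μ) * ⟪S (Y j), Y j⟫_ℝ - ‖S (Y j)‖ ^ 2 + 2 * l * μ * ‖Z (j + 1)‖ ^ 2
      ≤ ρ ^ (2 * j) * (10 * l ^ 2 * ρ ^ 2 * ‖z₀ - x‖ ^ 2) := by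
    intro j
    induction j with
    | zero =>
      have hκ : l - μ = l * (ρ * (2 - ρ)) := by rw [hμρ]; ring
      have hκ2 : (l - μ) ^ 2 ≤ 4 * l ^ 2 * ρ ^ 2 := by
        rw [hκ]
        have : (2 - ρ) ^ 2 ≤ 4 := by nlinarith
        nlinarith [mul_nonneg (sq_nonneg l) (sq_nonneg ρ)]
      have hz2 : ‖Z 1‖ ^ 2 = ρ ^ 2 * ‖z₀ - x‖ ^ 2
          - 2 * ρ * (1 / (l * (1 - ρ))) * ⟪S (z₀ - x), z₀ - x⟫_ℝ
          + (1 / (l * (1 - ρ))) ^ 2 * ‖S (z₀ - x)‖ ^ 2 := by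
        rw [hZs 0, hZ0, hY0, ← real_inner_self_eq_norm_sq, ← real_inner_self_eq_norm_sq (z₀ - x),
          ← real_inner_self_eq_norm_sq (S (z₀ - x))]
        simp only [inner_sub_left (ρ • (z₀ - x)), inner_sub_right _ (ρ • (z₀ - x)),
          inner_smul_left, inner_smul_right, conj_trivial]
        rw [real_inner_comm (z₀ - x) (S (z₀ - x))]
        ring
      have hz3 : 2 * l * μ * ‖Z 1‖ ^ 2
          ≤ 2 * l * μ * ρ ^ 2 * ‖z₀ - x‖ ^ 2 + 2 * ‖S (z₀ - x)‖ ^ 2 := by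
        have e : 2 * l * μ * (1 / (l * (1 - ρ))) ^ 2 = 2 := by
          rw [hμρ]; field_simp
        have e2 : 0 ≤ 2 * l * μ * (2 * ρ * (1 / (l * (1 - ρ))) * ⟪S (z₀ - x), z₀ - x⟫_ℝ) := by
          have := hS0 (z₀ - x)
          have : 0 < 1 - ρ := by linarith
          positivity
        rw [hz2]
        linear_combination e2 + ‖S (z₀ - x)‖ ^ 2 * e
      have hz4 := hq (z₀ - x)
      have hz5 : (l - μ) * ⟪S (z₀ - x), z₀ - x⟫_ℝ ≤ 4 * l ^ 2 * ρ ^ 2 * ‖z₀ - x‖ ^ 2 := by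
        calc _ ≤ (l - μ) * ((l - μ) * ‖z₀ - x‖ ^ 2) :=
              mul_le_mul_of_nonneg_left (hS1 _) (by linarith)
          _ = (l - μ) ^ 2 * ‖z₀ - x‖ ^ 2 := by ring
          _ ≤ _ := mul_le_mul_of_nonneg_right hκ2 (sq_nonneg _)
      have hz6 : 2 * l * μ * ρ ^ 2 * ‖z₀ - x‖ ^ 2 ≤ 2 * l * l * ρ ^ 2 * ‖z₀ - x‖ ^ 2 := by
        gcongr
      rw [hY0, zero_add, mul_zero, pow_zero, one_mul]
      linarith [sq_nonneg ‖S (z₀ - x)‖]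
    | succ j ih =>
      refine (lyapunov_step hS hl h0 h1 hμρ hq (hYs j) (hZs (j + 1))).trans ?_
      refine (mul_le_mul_of_nonneg_left ih (sq_nonneg ρ)).trans (le_of_eq ?_)
      ring
  change ‖Z K‖ ^ 2 ≤ _
  cases K with
  | zero =>
    rw [hZ0, mul_zero, pow_zero, mul_one]
    nlinarith [sq_nonneg ‖z₀ - x‖]
  | succ j =>
    have h2 := hV j
    have h3 := hq (Y j)
    have h4 : 2 * l * μ * ‖Z (j + 1)‖ ^ 2 ≤ 2 * l * μ * (5 * (l / μ) * ρ ^ (2 * (j + 1))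
        * ‖z₀ - x‖ ^ 2) := by
      have : 2 * l * μ * (5 * (l / μ) * ρ ^ (2 * (j + 1)) * ‖z₀ - x‖ ^ 2)
          = ρ ^ (2 * j) * (10 * l ^ 2 * ρ ^ 2 * ‖z₀ - x‖ ^ 2) := by
        field_simp; ring
      rw [this]; linarith
    exact le_of_mul_le_mul_left h4 (by positivity)

/-- Triple momentum reduces the suboptimality by the factor `5 ζ² ρ^{2K}`. -/
theorem momentumZ_suboptimality_le {F : E → ℝ} {G : E → E} {T : E →ₗ[ℝ] E}
    (hF : IsQuadratic F G T) {μ l : ℝ} (hμ : 0 < μ) (hμl : μ ≤ l)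
    (hT : ∀ w, μ * ‖w‖ ^ 2 ≤ ⟪T w, w⟫_ℝ) (hT' : ∀ w, ‖T w‖ ≤ l * ‖w‖)
    {x : E} (hx : G x = 0) (z₀ : E) (K : ℕ) :
    F (momentumZ (tripleMomentumStepsizes μ l) G z₀ K) - F x
      ≤ 5 * (l / μ) ^ 2 * (1 - 1 / √(l / μ)) ^ (2 * K) * (F z₀ - F x) := by
  have h1 := norm_momentumZ_sub_sq_le hF hμ hμl hT hT' hx z₀ K
  have hl : 0 < l := hμ.trans_le hμl
  rw [hF.eq_of_grad_eq_zero hx z₀, hF.eq_of_grad_eq_zero hx (momentumZ _ _ _ _)]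
  generalize momentumZ (tripleMomentumStepsizes μ l) G z₀ K - x = e at *
  have h2 : ⟪T e, e⟫_ℝ ≤ l * ‖e‖ ^ 2 := by
    have h2 : ⟪T e, e⟫_ℝ ≤ ‖T e‖ * ‖e‖ := real_inner_le_norm _ _
    have h3 := mul_le_mul_of_nonneg_right (hT' e) (norm_nonneg e)
    nlinarith
  have h3 := hT (z₀ - x)
  have hr : 0 ≤ (1 - 1 / √(l / μ)) ^ (2 * K) := (even_two_mul K).pow_nonneg _
  have h4 : 0 ≤ 5 * (l / μ) ^ 2 * (1 - 1 / √(l / μ)) ^ (2 * K) := by positivity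
  have h5 := mul_le_mul_of_nonneg_left h3 h4
  have h6 : 5 * (l / μ) ^ 2 * (1 - 1 / √(l / μ)) ^ (2 * K) * (μ * ‖z₀ - x‖ ^ 2)
      = l * (5 * (l / μ) * (1 - 1 / √(l / μ)) ^ (2 * K) * ‖z₀ - x‖ ^ 2) := by
    field_simp
  have h7 := mul_le_mul_of_nonneg_left h1 hl.le
  linarith

end Lyapunov

/-! ### The state, the input and the cost as functions of `z` -/

section Sequences

variable {m : ℕ} {p : Fin m → ℕ+}

theorem le_controllabilityIndex (p : Fin m → ℕ+) (i : Fin m) :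
    (p i : ℕ) ≤ controllabilityIndex p :=
  Finset.le_sup (f := fun i => (p i : ℕ)) (Finset.mem_univ i)

theorem quad_eq_inner {ι : Type*} [Fintype ι] [DecidableEq ι] (M : Matrix ι ι ℝ)
    (v : EuclideanSpace ℝ ι) : quad M v = ⟪M.toEuclideanLin v, v⟫_ℝ := by
  rw [EuclideanSpace.inner_eq_star_dotProduct, Matrix.ofLp_toLpLin]
  rfl

/-- `z ↦ x_t` as a linear map. -/
def stateLin (p : Fin m → ℕ+) (t : ℤ) : (ℤ → Input m) →ₗ[ℝ] State p where
  toFun z := stateOf z t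
  map_add' _ _ := by ext; simp [stateOf]
  map_smul' _ _ := by ext; simp [stateOf]

/-- `z ↦ u_t` as a linear map. -/
def inputLin (A : Matrix (StateIndex p) (StateIndex p) ℝ) (t : ℤ) :
    (ℤ → Input m) →ₗ[ℝ] Input m :=
  LinearMap.proj (t + 1) - (keyRows p A).toEuclideanLin ∘ₗ stateLin p t

theorem inputLin_apply (A : Matrix (StateIndex p) (StateIndex p) ℝ) (t : ℤ) (z : ℤ → Input m) :
    inputLin A t z = z (t + 1) - (keyRows p A).toEuclideanLin (stateLin p t z) := rfl

theorem stateLin_apply (t : ℤ) (z : ℤ → Input m) (s : StateIndex p) :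
    stateLin p t z s = z (t - ((p s.1 : ℕ) : ℤ) + 1 + ((s.2 : ℕ) : ℤ)) s.1 := rfl

theorem stateLin_congr {t : ℤ} {z z' : ℤ → Input m}
    (h : ∀ k, t - controllabilityIndex p < k → k ≤ t → z k = z' k) :
    stateLin p t z = stateLin p t z' := by
  ext s
  rw [stateLin_apply, stateLin_apply, h]
  · have := le_controllabilityIndex p s.1; omega
  · have := s.2.2; omega

theorem inputLin_congr {A : Matrix (StateIndex p) (StateIndex p) ℝ} {t : ℤ} {z z' : ℤ → Input m}
    (h : ∀ k, t - controllabilityIndex p < k → k ≤ t + 1 → z k = z' k) :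
    inputLin A t z = inputLin A t z' := by
  rcases isEmpty_or_nonempty (Fin m) with hm | ⟨⟨i⟩⟩
  · exact Subsingleton.elim _ _
  have := le_controllabilityIndex p i
  have := (p i).pos
  rw [inputLin_apply, inputLin_apply, h (t + 1) (by omega) le_rfl,
    stateLin_congr fun k h1 h2 => h k h1 (by omega)]

theorem norm_stateLin_le {t : ℤ} {z : ℤ → Input m} {b : ℝ} (hb : 0 ≤ b)
    (h : ∀ k, t - controllabilityIndex p < k → k ≤ t → ‖z k‖ ≤ b) :
    ‖stateLin p t z‖ ≤ √(Fintype.card (StateIndex p)) * b := by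
  rw [EuclideanSpace.norm_eq, ← Real.sqrt_sq hb, ← Real.sqrt_mul (by positivity)]
  apply Real.sqrt_le_sqrt
  have : ∀ s ∈ (Finset.univ : Finset (StateIndex p)), ‖stateLin p t z s‖ ^ 2 ≤ b ^ 2 := by
    intro s _
    gcongr
    rw [stateLin_apply]
    refine (PiLp.norm_apply_le _ _).trans (h _ ?_ ?_)
    · have := le_controllabilityIndex p s.1; omega
    · have := s.2.2; omega
  simpa using Finset.sum_le_sum this

/-- The vector `(z_1, …, z_N)` as a sequence, as a linear map. -/
def extendLin (m N : ℕ) : EuclideanSpace ℝ (Fin N × Fin m) →ₗ[ℝ] (ℤ → Input m) where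
  toFun := extend N
  map_add' z w := by
    funext t
    simp only [extend, Pi.add_apply]
    split_ifs
    · rfl
    · simp
  map_smul' c z := by
    funext t
    simp only [extend, Pi.smul_apply, RingHom.id_apply]
    split_ifs
    · rfl
    · simp

theorem extendLin_of_not_mem {N : ℕ} {t : ℤ} (h : ¬ (1 ≤ t ∧ t ≤ (N : ℤ)))
    (z : EuclideanSpace ℝ (Fin N × Fin m)) : extendLin m N z t = 0 := dif_neg h

theorem extendLin_succ {N : ℕ} (z : EuclideanSpace ℝ (Fin N × Fin m)) (k : Fin N) (i : Fin m) :
    extendLin m N z ((k : ℕ) + 1) i = z (k, i) := by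
  have h : 1 ≤ ((k : ℕ) : ℤ) + 1 ∧ ((k : ℕ) : ℤ) + 1 ≤ (N : ℤ) := by
    have := k.2; omega
  change extend N z _ i = _
  rw [extend, dif_pos h]
  simp

theorem exists_extendLin_eq {N : ℕ} {z : ℤ → Input m}
    (hz : ∀ t, ¬ (1 ≤ t ∧ t ≤ (N : ℤ)) → z t = 0) : ∃ v, extendLin m N v = z := by
  refine ⟨WithLp.toLp 2 fun q => z ((q.1 : ℕ) + 1) q.2, ?_⟩
  funext t
  by_cases h : 1 ≤ t ∧ t ≤ (N : ℤ)
  · obtain ⟨k, rfl⟩ : ∃ k : Fin N, t = (k : ℕ) + 1 := ⟨⟨(t - 1).toNat, by omega⟩, by simp; omega⟩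
    ext i
    rw [extendLin_succ]
  · rw [extendLin_of_not_mem h, hz t h]

theorem norm_sq_eq_sum_extendLin {N : ℕ} (z : EuclideanSpace ℝ (Fin N × Fin m)) :
    ‖z‖ ^ 2 = ∑ k ∈ Finset.range N, ‖extendLin m N z ((k : ℤ) + 1)‖ ^ 2 := by
  rw [EuclideanSpace.norm_sq_eq, Fintype.sum_prod_type, Finset.sum_range]
  refine Finset.sum_congr rfl fun k _ => ?_
  rw [EuclideanSpace.norm_sq_eq]
  simp only [extendLin_succ]

theorem extendLin_single {N : ℕ} (k : Fin N) (i : Fin m) :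
    extendLin m N (EuclideanSpace.single (k, i) 1)
      = Pi.single ((k : ℕ) + 1 : ℤ) (EuclideanSpace.single i (1 : ℝ)) := by
  funext t
  by_cases h : 1 ≤ t ∧ t ≤ (N : ℤ)
  · obtain ⟨j, rfl⟩ : ∃ k : Fin N, t = (k : ℕ) + 1 := ⟨⟨(t - 1).toNat, by omega⟩, by simp; omega⟩
    ext a
    rw [extendLin_succ]
    by_cases hj : j = k
    · subst hj
      simp
    · have hj' : ((j : ℕ) : ℤ) + 1 ≠ (k : ℕ) + 1 := by
        intro h'; apply hj; ext; omega
      rw [Pi.single_eq_of_ne hj']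
      simp [hj]
  · rw [extendLin_of_not_mem h, Pi.single_eq_of_ne]
    rintro rfl
    have := k.2
    omega

theorem update_eq_add_single (z : ℤ → Input m) (s : ℤ) (v : Input m) :
    Function.update z s v = Function.update z s 0 + Pi.single s v := by
  funext t
  by_cases h : t = s
  · subst h; simp
  · simp [h]

end Sequences

/-! ### The cost of the tracking problem -/

section Tracking

variable {m : ℕ} {p : Fin m → ℕ+}
  {A : Matrix (StateIndex p) (StateIndex p) ℝ} {B : Matrix (StateIndex p) (Fin m) ℝ}
  {Q : Matrix (StateIndex p) (StateIndex p) ℝ} {R : Matrix (Fin m) (Fin m) ℝ}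
  {P : Matrix (StateIndex p) (StateIndex p) ℝ} {N : ℕ} {θ : ℕ → State p}

/-- The operator of the quadratic state cost at stage `t`: `Q` before the horizon and `P` at it. -/
def weight (Q P : Matrix (StateIndex p) (StateIndex p) ℝ) (N t : ℕ) : State p →ₗ[ℝ] State p :=
  if t < N then Q.toEuclideanLin else P.toEuclideanLin

/-- The reference `θ_0, …, θ_{N-1}`, extended to `ℤ` by `0`. -/
def target (N : ℕ) (θ : ℕ → State p) (t : ℤ) : State p :=
  if 0 ≤ t ∧ t < (N : ℤ) then θ t.toNat else 0

theorem weight_isSymmetric (hQ : Q.IsHermitian) (hP : P.IsHermitian) (N t : ℕ) :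
    (weight Q P N t).IsSymmetric := by
  unfold weight
  split_ifs
  · exact Matrix.isSymmetric_toEuclideanLin_iff.2 hQ
  · exact Matrix.isSymmetric_toEuclideanLin_iff.2 hP

theorem lqTracking_f (t : ℕ) (x : State p) : (lqTracking A B Q R P N θ).f t x
    = 1 / 2 * ⟪weight Q P N t (x - target N θ t), x - target N θ t⟫_ℝ := by
  simp only [lqTracking, weight, target, quad_eq_inner]
  by_cases h : t < N
  · simp [h]
  · simp [h]

theorem lqTracking_g (t : ℕ) (u : Input m) : (lqTracking A B Q R P N θ).g t u
    = 1 / 2 * ⟪R.toEuclideanLin (u - 0), u - 0⟫_ℝ := by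
  simp only [lqTracking, quad_eq_inner, sub_zero]

theorem lqTracking_fz (t : ℕ) (z : ℤ → Input m) : (lqTracking A B Q R P N θ).fz t z
    = 1 / 2 * ⟪weight Q P N t (stateLin p t z - target N θ t),
        stateLin p t z - target N θ t⟫_ℝ :=
  lqTracking_f t _

theorem lqTracking_gz (t : ℕ) (z : ℤ → Input m) : (lqTracking A B Q R P N θ).gz t z
    = 1 / 2 * ⟪R.toEuclideanLin (inputLin A t z - 0), inputLin A t z - 0⟫_ℝ :=
  lqTracking_g t _

/-- The gradient of a quadratic stage cost in the single variable `z_s`. -/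
theorem inner_gradient_update {V : Type*} [NormedAddCommGroup V] [InnerProductSpace ℝ V]
    [FiniteDimensional ℝ V] {M : V →ₗ[ℝ] V} (hM : M.IsSymmetric)
    (L : (ℤ → Input m) →ₗ[ℝ] V) (b : V) (z : ℤ → Input m) (s : ℤ) (v : Input m) :
    ⟪gradient (fun v : Input m => 1 / 2 * ⟪M (L (Function.update z s v) - b),
      L (Function.update z s v) - b⟫_ℝ) (z s), v⟫_ℝ = ⟪M (L z - b), L (Pi.single s v)⟫_ℝ := by
  have h := (isQuadratic_comp hM (L ∘ₗ LinearMap.single ℝ (fun _ : ℤ => Input m) s)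
    (b - L (Function.update z s 0))).hasGradientAt (z s)
  have h2 : ∀ v : Input m, (L ∘ₗ LinearMap.single ℝ (fun _ : ℤ => Input m) s) v
      - (b - L (Function.update z s 0)) = L (Function.update z s v) - b := by
    intro v
    rw [update_eq_add_single z s v, map_add]
    simp only [LinearMap.comp_apply, LinearMap.coe_single]
    abel
  simp only [h2] at h
  rw [h.gradient, LinearMap.adjoint_inner_left, Function.update_eq_self]
  rfl

/-- The directional derivative of the cost at the sequence `z` in the direction `w`. -/
def costDeriv (A Q : Matrix (StateIndex p) (StateIndex p) ℝ) (R : Matrix (Fin m) (Fin m) ℝ)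
    (P : Matrix (StateIndex p) (StateIndex p) ℝ) (N : ℕ) (θ : ℕ → State p)
    (z w : ℤ → Input m) : ℝ :=
  (∑ t ∈ Finset.range (N + 1),
      ⟪weight Q P N t (stateLin p t z - target N θ t), stateLin p t w⟫_ℝ) +
    ∑ t ∈ Finset.range N, ⟪R.toEuclideanLin (inputLin A t z), inputLin A t w⟫_ℝ

theorem inner_partialC (hQ : Q.IsHermitian) (hR : R.IsHermitian) (hP : P.IsHermitian)
    (s : ℤ) (z : ℤ → Input m) (v : Input m) :
    ⟪(lqTracking A B Q R P N θ).partialC s z, v⟫_ℝ =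
      (∑ t ∈ (Finset.range (N + 1)).filter (fun t : ℕ =>
          s ≤ (t : ℤ) ∧ (t : ℤ) ≤ s + (controllabilityIndex p : ℤ) - 1),
        ⟪weight Q P N t (stateLin p t z - target N θ t), stateLin p t (Pi.single s v)⟫_ℝ) +
      ∑ t ∈ (Finset.range N).filter (fun t : ℕ =>
          s - 1 ≤ (t : ℤ) ∧ (t : ℤ) ≤ s + (controllabilityIndex p : ℤ) - 1),
        ⟪R.toEuclideanLin (inputLin A t z), inputLin A t (Pi.single s v)⟫_ℝ := by
  unfold Problem.partialC
  rw [inner_add_left, sum_inner, sum_inner]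
  congr 1
  · refine Finset.sum_congr rfl fun t _ => ?_
    simp only [lqTracking_fz]
    exact inner_gradient_update (weight_isSymmetric hQ hP N t) _ _ z s v
  · refine Finset.sum_congr rfl fun t _ => ?_
    simp only [lqTracking_gz]
    rw [inner_gradient_update (Matrix.isSymmetric_toEuclideanLin_iff.2 hR), sub_zero]

theorem stateLin_single_eq_zero {s t : ℤ} (v : Input m)
    (h : ¬ (s ≤ t ∧ t ≤ s + (controllabilityIndex p : ℤ) - 1)) :
    stateLin p t (Pi.single s v) = 0 := by
  rw [← map_zero (stateLin p t)]
  refine stateLin_congr fun k h1 h2 => ?_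
  rw [Pi.single_eq_of_ne (by omega)]
  rfl

theorem inputLin_single_eq_zero {s t : ℤ} (v : Input m)
    (h : ¬ (s - 1 ≤ t ∧ t ≤ s + (controllabilityIndex p : ℤ) - 1)) :
    inputLin A t (Pi.single s v) = 0 := by
  rw [inputLin_apply, stateLin_single_eq_zero v (by omega), map_zero, sub_zero,
    Pi.single_eq_of_ne (by omega)]

theorem inner_partialC_eq_costDeriv (hQ : Q.IsHermitian) (hR : R.IsHermitian)
    (hP : P.IsHermitian) (s : ℤ) (z : ℤ → Input m) (v : Input m) :
    ⟪(lqTracking A B Q R P N θ).partialC s z, v⟫_ℝ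
      = costDeriv A Q R P N θ z (Pi.single s v) := by
  rw [inner_partialC hQ hR hP, costDeriv]
  congr 1
  · refine Finset.sum_filter_of_ne fun t _ h => ?_
    by_contra h'
    exact h (by rw [stateLin_single_eq_zero v h', inner_zero_right])
  · refine Finset.sum_filter_of_ne fun t _ h => ?_
    by_contra h'
    exact h (by rw [inputLin_single_eq_zero v h', inner_zero_right])

theorem lqTracking_C (z : EuclideanSpace ℝ (Fin N × Fin m)) :
    (lqTracking A B Q R P N θ).C z =
      (∑ t ∈ Finset.range (N + 1), (lqTracking A B Q R P N θ).fz t (extendLin m N z)) +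
        ∑ t ∈ Finset.range N, (lqTracking A B Q R P N θ).gz t (extendLin m N z) := rfl

/-- The objective `C` is quadratic; its gradient consists of the partial gradients, and its Hessian
form is twice the cost for the reference `0`. -/
theorem exists_isQuadratic_C (hQ : Q.IsHermitian) (hR : R.IsHermitian) (hP : P.IsHermitian) :
    ∃ (G : EuclideanSpace ℝ (Fin N × Fin m) → EuclideanSpace ℝ (Fin N × Fin m))
      (T : EuclideanSpace ℝ (Fin N × Fin m) →ₗ[ℝ] EuclideanSpace ℝ (Fin N × Fin m)),
      IsQuadratic (fun z => (lqTracking A B Q R P N θ).C z) G T ∧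
      (∀ z, extendLin m N (G z) = fun t => if 1 ≤ t ∧ t ≤ (N : ℤ) then
        (lqTracking A B Q R P N θ).partialC t (extendLin m N z) else 0) ∧
      ∀ w, ⟪T w, w⟫_ℝ =
        (∑ t ∈ Finset.range (N + 1), ⟪weight Q P N t (stateLin p t (extendLin m N w)),
          stateLin p t (extendLin m N w)⟫_ℝ) +
        ∑ t ∈ Finset.range N, ⟪R.toEuclideanLin (inputLin A t (extendLin m N w)),
          inputLin A t (extendLin m N w)⟫_ℝ := by
  have h := (IsQuadratic.sum (Finset.range (N + 1)) fun t _ =>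
      isQuadratic_comp (weight_isSymmetric hQ hP N t) (stateLin p t ∘ₗ extendLin m N)
        (target N θ t)).add
    (IsQuadratic.sum (Finset.range N) fun t _ =>
      isQuadratic_comp (Matrix.isSymmetric_toEuclideanLin_iff.2 hR)
        (inputLin A t ∘ₗ extendLin m N) 0)
  refine ⟨_, _, h.congr fun z => ?_, ?_, ?_⟩
  · rw [lqTracking_C]
    congr 1
    · exact Finset.sum_congr rfl fun t _ => lqTracking_fz t _
    · exact Finset.sum_congr rfl fun t _ => lqTracking_gz t _
  · intro z
    refine funext fun t => ?_
    split_ifs with ht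
    · obtain ⟨k, rfl⟩ : ∃ k : Fin N, t = (k : ℕ) + 1 :=
        ⟨⟨(t - 1).toNat, by omega⟩, by simp; omega⟩
      ext i
      rw [extendLin_succ]
      have e1 : ∀ x : EuclideanSpace ℝ (Fin N × Fin m),
          x (k, i) = ⟪x, EuclideanSpace.single (k, i) 1⟫_ℝ := by
        intro x; simp [EuclideanSpace.inner_single_right]
      have e2 : ∀ x : Input m, x i = ⟪x, EuclideanSpace.single i 1⟫_ℝ := by
        intro x; simp [EuclideanSpace.inner_single_right]
      rw [e1, e2, inner_partialC_eq_costDeriv hQ hR hP, ← extendLin_single, costDeriv,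
        inner_add_left, sum_inner, sum_inner]
      simp only [LinearMap.adjoint_inner_left, LinearMap.comp_apply, sub_zero]
    · exact extendLin_of_not_mem ht _
  · intro w
    simp only [LinearMap.add_apply, inner_add_left, LinearMap.sum_apply, sum_inner,
      LinearMap.comp_apply, LinearMap.adjoint_inner_left]

end Tracking

/-! ### The online iterates are the iterates of triple momentum -/

section Online

variable {m : ℕ} {p : Fin m → ℕ+}

theorem Problem.partialC_congr (S : Problem p) {s : ℤ} {z z' : ℤ → Input m}
    (h : ∀ k, s - controllabilityIndex p ≤ k → k ≤ s + controllabilityIndex p → z k = z' k) :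
    S.partialC s z = S.partialC s z' := by
  have hs : z s = z' s := h s (by omega) (by omega)
  have hu : ∀ (v : Input m) (k : ℤ), s - controllabilityIndex p ≤ k →
      k ≤ s + controllabilityIndex p →
      Function.update z s v k = Function.update z' s v k := by
    intro v k h1 h2
    by_cases hk : k = s
    · subst hk; simp
    · simp [hk, h k h1 h2]
  unfold Problem.partialC
  rw [hs]
  congr 1
  · refine Finset.sum_congr rfl fun t ht => ?_
    have ht := (Finset.mem_filter.1 ht).2
    congr 1
    funext v
    exact congrArg (S.f t) (stateLin_congr fun k h1 h2 => hu v k (by omega) (by omega))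
  · refine Finset.sum_congr rfl fun t ht => ?_
    have ht := (Finset.mem_filter.1 ht).2
    congr 1
    funext v
    exact congrArg (S.g t) (inputLin_congr fun k h1 h2 => hu v k (by omega) (by omega))

/-- The gradient of `C` as a field on sequences supported in the stages `1, …, N`. -/
def Problem.seqGrad (S : Problem p) (z : ℤ → Input m) (s : ℤ) : Input m :=
  if 1 ≤ s ∧ s ≤ (S.N : ℤ) then S.partialC s z else 0

/-- The initial sequence `z(0)` built from the initialization `φ`. -/
def initialSeq (N : ℕ) (φ : ℕ → Input m) (s : ℤ) : Input m :=
  if 1 ≤ s ∧ s ≤ (N : ℤ) then φ (s - 1).toNat else 0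

theorem Problem.momentum_eq_zero (S : Problem p) (γ : Stepsizes) (φ : ℕ → Input m) {s : ℤ}
    (hs : ¬ (1 ≤ s ∧ s ≤ (S.N : ℤ))) (j : ℕ) :
    (momentum γ S.seqGrad (initialSeq S.N φ) j).1 s = 0 ∧
      (momentum γ S.seqGrad (initialSeq S.N φ) j).2 s = 0 := by
  induction j with
  | zero => exact ⟨if_neg hs, if_neg hs⟩
  | succ j ih =>
    refine ⟨?_, ih.1⟩
    simp [momentum, ih.1, ih.2, Problem.seqGrad, hs]

/-- Position `(j, s)` of the memory agrees with the `j`-th iterate of triple momentum. -/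
structure Problem.Agrees (S : Problem p) (γ : Stepsizes) (φ : ℕ → Input m) (M : Memory m)
    (j : ℕ) (s : ℤ) : Prop where
  ω : M.ω j s = (momentum γ S.seqGrad (initialSeq S.N φ) j).1 s
  prev : M.ω (j - 1) s = (momentum γ S.seqGrad (initialSeq S.N φ) j).2 s
  y : M.y j s = momentumY γ S.seqGrad (initialSeq S.N φ) j s
  z : M.z j s = momentumZ γ S.seqGrad (initialSeq S.N φ) j s

/-- The entries of the memory for the stages outside `1, …, N` vanish. -/
def Memory.VanishesOutside (M : Memory m) (N : ℕ) : Prop :=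
  ∀ j s, ¬ (1 ≤ s ∧ s ≤ (N : ℤ)) → M.ω j s = 0 ∧ M.y j s = 0 ∧ M.z j s = 0

theorem Problem.agrees_of_not_mem (S : Problem p) (γ : Stepsizes) (φ : ℕ → Input m)
    {M : Memory m} (hM : M.VanishesOutside S.N) (j : ℕ) {s : ℤ}
    (hs : ¬ (1 ≤ s ∧ s ≤ (S.N : ℤ))) : S.Agrees γ φ M j s := by
  have h := S.momentum_eq_zero γ φ hs j
  refine ⟨?_, ?_, ?_, ?_⟩
  · rw [(hM _ s hs).1, h.1]
  · rw [(hM _ s hs).1, h.2]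
  · rw [(hM _ s hs).2.1]; simp [momentumY, h]
  · rw [(hM _ s hs).2.2]; simp [momentumZ, h]

theorem store_apply (a : ℤ → ℤ → Input m) (j s : ℤ) (v : Input m) (j' s' : ℤ) :
    store a j s v j' s' = if j' = j ∧ s' = s then v else a j' s' := by
  unfold store
  by_cases hj : j' = j
  · subst hj
    by_cases hs : s' = s
    · subst hs; simp
    · simp [hs]
  · simp [hj]

/-- After the updates `1, …, k` of the pass for the stage `i + 1`, the `j`-th iterate is available
for the stages `s` with `s + j p ≤ i + 1` if `j ≤ k`, and `s + j p ≤ i` otherwise. -/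
theorem Problem.pass_invariant (S : Problem p) (hp : 1 ≤ controllabilityIndex p)
    (γ : Stepsizes) (φ : ℕ → Input m) {i K : ℕ} {M : Memory m} (hM0 : M.VanishesOutside S.N)
    (hM : ∀ j : ℕ, j ≤ K → ∀ s : ℤ, s + j * (controllabilityIndex p : ℤ) ≤ i →
      S.Agrees γ φ M j s) (k : ℕ) (hk : k ≤ K) :
    (S.pass γ φ i M k).VanishesOutside S.N ∧
      ∀ j : ℕ, j ≤ K → ∀ s : ℤ,
        s + j * (controllabilityIndex p : ℤ) ≤ (if j ≤ k then (i : ℤ) + 1 else i) →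
        S.Agrees γ φ (S.pass γ φ i M k) j s := by
  set P : ℤ := (controllabilityIndex p : ℤ) with hP
  have hP1 : 1 ≤ P := by omega
  induction k with
  | zero =>
    have hstep : (S.pass γ φ i M 0).VanishesOutside S.N := by
      simp only [Problem.pass]
      split_ifs with hi
      · intro j s hs
        have : ¬ (s = (i : ℤ) + 1) := by omega
        simp only [Memory.init, store_apply, this, and_false, if_false]
        exact hM0 j s hs
      · exact hM0
    refine ⟨hstep, fun j hj s hs => ?_⟩
    by_cases hsN : 1 ≤ s ∧ s ≤ (S.N : ℤ)
    swap
    · exact S.agrees_of_not_mem γ φ hstep j hsN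
    by_cases hj0 : j = 0
    · subst hj0
      by_cases hsi : s = (i : ℤ) + 1
      · have hi : i + 1 ≤ S.N := by omega
        have h0 : initialSeq S.N φ s = φ i := by
          rw [initialSeq, if_pos hsN, hsi]; simp
        simp only [Problem.pass, if_pos hi]
        constructor
        · simp [Memory.init, store_apply, hsi, momentum, ← h0]
        · simp [Memory.init, store_apply, hsi, momentum, ← h0]
        · simp [Memory.init, store_apply, hsi, momentumY, momentum, ← h0, add_smul]
        · simp [Memory.init, store_apply, hsi, momentumZ, momentum, ← h0, add_smul]
      · have h := hM 0 hj s (by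
          rw [if_pos le_rfl] at hs
          push_cast at hs ⊢
          rw [zero_mul] at hs ⊢; omega)
        simp only [Problem.pass]
        split_ifs with hi
        · constructor
          · simpa [Memory.init, store_apply, hsi] using h.ω
          · simpa [Memory.init, store_apply, hsi] using h.prev
          · simpa [Memory.init, store_apply, hsi] using h.y
          · simpa [Memory.init, store_apply, hsi] using h.z
        · exact h
    · rw [if_neg (by omega)] at hs
      have h := hM j hj s hs
      have hsi : ¬ (s = (i : ℤ) + 1) := by
        have : 0 ≤ (j : ℤ) * P := by positivity
        omega
      simp only [Problem.pass]
      split_ifs with hi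
      · constructor
        · simpa [Memory.init, store_apply, hsi] using h.ω
        · simpa [Memory.init, store_apply, hsi] using h.prev
        · simpa [Memory.init, store_apply, hsi] using h.y
        · simpa [Memory.init, store_apply, hsi] using h.z
      · exact h
  | succ k ih =>
    obtain ⟨ih0, ih⟩ := ih (by omega)
    generalize hM' : S.pass γ φ i M k = M' at ih0 ih
    set σ : ℤ := (i : ℤ) + 1 - ((k : ℤ) + 1) * P with hσ
    have hpass : S.pass γ φ i M (k + 1)
        = if 1 ≤ σ ∧ σ ≤ (S.N : ℤ) then S.update γ σ ((k : ℤ) + 1) M' else M' := by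
      simp only [Problem.pass, hM']
      rfl
    rw [hpass]
    have hstep : (if 1 ≤ σ ∧ σ ≤ (S.N : ℤ) then S.update γ σ ((k : ℤ) + 1) M'
        else M').VanishesOutside S.N := by
      split_ifs with hi
      · intro j s hs
        have : ¬ (s = σ) := by rintro rfl; exact hs hi
        simp only [Problem.update, store_apply, this, and_false, if_false]
        exact ih0 j s hs
      · exact ih0
    refine ⟨hstep, fun j hj s hs => ?_⟩
    by_cases hsN : 1 ≤ s ∧ s ≤ (S.N : ℤ)
    swap
    · exact S.agrees_of_not_mem γ φ hstep j hsN
    by_cases hnew : j = k + 1 ∧ s = σ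
    · obtain ⟨rfl, rfl⟩ := hnew
      have h := ih k (by omega) σ (by
        rw [if_pos le_rfl]
        have : ((k : ℤ) + 1) * P = k * P + P := by ring
        omega)
      -- the gradient at stage `σ` only reads `y(k)` at stages for which it is available
      have hg : S.partialC σ (M'.y k)
          = S.seqGrad (momentumY γ S.seqGrad (initialSeq S.N φ) k) σ := by
        rw [Problem.seqGrad, if_pos hsN]
        refine S.partialC_congr fun q h1 h2 => (ih k (by omega) q ?_).y
        rw [if_pos le_rfl]
        have : ((k : ℤ) + 1) * P = k * P + P := by ring
        omega
      have hω : (1 + γ.ω) • M'.ω k σ - γ.ω • M'.ω (k - 1) σ - γ.c • S.partialC σ (M'.y k)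
          = (momentum γ S.seqGrad (initialSeq S.N φ) (k + 1)).1 σ := by
        rw [hg, h.ω, h.prev]
        rfl
      rw [if_pos hsN]
      have e1 : (k : ℤ) + 1 - 1 = k := by ring
      have e2 : (k : ℤ) + 1 - 2 = k - 1 := by ring
      constructor
      · simp only [Problem.update, store_apply, Nat.cast_add, Nat.cast_one, and_self, if_true,
          e1, e2, hω]
      · have : ¬ ((k : ℤ) = k + 1) := by omega
        simp only [Problem.update, store_apply, Nat.cast_add, Nat.cast_one, e1, this, false_and,
          if_false, h.ω]
        rfl
      · simp only [Problem.update, store_apply, Nat.cast_add, Nat.cast_one, and_self, if_true,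
          e1, e2, hω]
        rw [h.ω]
        rfl
      · simp only [Problem.update, store_apply, Nat.cast_add, Nat.cast_one, and_self, if_true,
          e1, e2, hω]
        rw [h.ω]
        rfl
    · -- an entry that was available before and is not overwritten
      have hold : s + j * P ≤ if j ≤ k then (i : ℤ) + 1 else i := by
        rcases Nat.lt_trichotomy j (k + 1) with hlt | rfl | hgt
        · rw [if_pos (by omega)] at hs ⊢
          exact hs
        · rw [if_pos le_rfl] at hs
          rw [if_neg (by omega)]
          have : s ≠ σ := fun h => hnew ⟨rfl, h⟩
          push_cast at hs ⊢
          omega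
        · rw [if_neg (by omega)] at hs ⊢
          exact hs
      have h := ih j hj s hold
      split_ifs with hi
      · have h1 : ¬ ((j : ℤ) = (k : ℤ) + 1 ∧ s = σ) := by
          rintro ⟨h1, h2⟩; exact hnew ⟨by omega, h2⟩
        -- `ω(k+1)` at stage `σ` is not yet read as the predecessor of `ω(k+2)`
        have h2 : ¬ ((j : ℤ) - 1 = (k : ℤ) + 1 ∧ s = σ) := by
          rintro ⟨h1, h2⟩
          rw [if_neg (by omega)] at hold
          have : (j : ℤ) * P = ((k : ℤ) + 1) * P + P := by
            rw [show (j : ℤ) = k + 1 + 1 by omega]; ring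
          omega
        constructor
        · simpa only [Problem.update, store_apply, h1, if_false] using h.ω
        · simpa only [Problem.update, store_apply, h2, if_false] using h.prev
        · simpa only [Problem.update, store_apply, h1, if_false] using h.y
        · simpa only [Problem.update, store_apply, h1, if_false] using h.z
      · exact h

theorem Problem.memory_invariant (S : Problem p) (hp : 1 ≤ controllabilityIndex p)
    (γ : Stepsizes) (W : ℕ) (φ : ℕ → Input m) (i : ℕ) :
    (S.memory γ W φ i).VanishesOutside S.N ∧
      ∀ j : ℕ, j ≤ numUpdates p W → ∀ s : ℤ, s + j * (controllabilityIndex p : ℤ) ≤ i →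
        S.Agrees γ φ (S.memory γ W φ i) j s := by
  induction i with
  | zero =>
    have h0 : (S.memory γ W φ 0).VanishesOutside S.N := fun _ _ _ => ⟨rfl, rfl, rfl⟩
    refine ⟨h0, fun j _ s hs => S.agrees_of_not_mem γ φ h0 j fun h => ?_⟩
    have : 0 ≤ (j : ℤ) * (controllabilityIndex p : ℤ) := by positivity
    push_cast at hs
    omega
  | succ i ih =>
    obtain ⟨h1, h2⟩ := S.pass_invariant hp γ φ ih.1 ih.2 (numUpdates p W) le_rfl
    refine ⟨h1, fun j hj s hs => h2 j hj s ?_⟩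
    rw [if_pos hj]
    exact_mod_cast hs

/-- At time `t` RHTM applies the `K`-th iterate of triple momentum for the stage `t + 1`. -/
theorem Problem.memory_z (S : Problem p) (γ : Stepsizes) {W : ℕ} (hW : 1 ≤ W)
    (φ : ℕ → Input m) (t : ℕ) :
    (S.memory γ W φ (t + W)).z (numUpdates p W : ℤ) ((t : ℤ) + 1)
      = momentumZ γ S.seqGrad (initialSeq S.N φ) (numUpdates p W) ((t : ℤ) + 1) := by
  rcases isEmpty_or_nonempty (Fin m) with hm | ⟨⟨i⟩⟩
  · exact Subsingleton.elim _ _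
  · have hp : 1 ≤ controllabilityIndex p := (p i).pos.trans_le (le_controllabilityIndex p i)
    refine ((S.memory_invariant hp γ W φ (t + W)).2 _ le_rfl _ ?_).z
    have : numUpdates p W * controllabilityIndex p ≤ W - 1 := Nat.div_mul_le_self _ _
    zify [hW] at this
    push_cast
    omega

end Online

/-! ### Trajectories and sequences -/

section Trajectories

variable {m : ℕ} {p : Fin m → ℕ+}
  {A : Matrix (StateIndex p) (StateIndex p) ℝ} {B : Matrix (StateIndex p) (Fin m) ℝ}

theorem IsCanonicalForm.step_apply (h : IsCanonicalForm p A B) (x : State p) (u : Input m)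
    (i : Fin m) (r : Fin (p i : ℕ)) :
    (A.toEuclideanLin x + B.toEuclideanLin u) ⟨i, r⟩ =
      if hr : (r : ℕ) + 1 < (p i : ℕ) then x ⟨i, ⟨(r : ℕ) + 1, hr⟩⟩
      else (keyRows p A).toEuclideanLin x i + u i := by
  have hB : (B.toEuclideanLin u) ⟨i, r⟩ = if (r : ℕ) + 1 < (p i : ℕ) then 0 else u i := by
    simp only [Matrix.toLpLin_apply, Matrix.mulVec, dotProduct, h.input]
    by_cases hr : (r : ℕ) + 1 < (p i : ℕ)
    · rw [if_pos hr]
      refine Finset.sum_eq_zero fun j _ => ?_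
      rw [if_neg, zero_mul]
      intro hj
      obtain rfl : i = j := congrArg Sigma.fst hj
      have := congrArg (fun q : Fin (p i : ℕ) => (q : ℕ)) (eq_of_heq (Sigma.mk.inj hj).2)
      simp at this
      omega
    · rw [if_neg hr, Finset.sum_eq_single i]
      · rw [if_pos, one_mul]
        have := r.2
        exact Sigma.ext rfl (heq_of_eq (Fin.ext (show (r : ℕ) = (p i : ℕ) - 1 by omega)))
      · intro j _ hj
        rw [if_neg, zero_mul]
        intro hj'
        exact hj (congrArg Sigma.fst hj').symm
      · simp
  rw [PiLp.add_apply, hB]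
  by_cases hr : (r : ℕ) + 1 < (p i : ℕ)
  · rw [dif_pos hr, if_pos hr, add_zero]
    simp only [Matrix.toLpLin_apply, Matrix.mulVec, dotProduct, h.shift i r hr]
    simp
  · rw [dif_neg hr, if_neg hr]
    congr 1
    have : (⟨i, r⟩ : StateIndex p) = lastIndex p i := by
      have := r.2
      exact Sigma.ext rfl (heq_of_eq (Fin.ext (show (r : ℕ) = (p i : ℕ) - 1 by omega)))
    rw [this]
    rfl

/-- The sequence `z` generates the trajectory: `x_{t+1} = A x_t + B u_t`. -/
theorem IsCanonicalForm.step_stateLin (h : IsCanonicalForm p A B) (z : ℤ → Input m) (t : ℤ)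
    {u : Input m} (hu : u = inputLin A t z) :
    A.toEuclideanLin (stateLin p t z) + B.toEuclideanLin u = stateLin p (t + 1) z := by
  subst hu
  ext ⟨i, r⟩
  rw [h.step_apply]
  have hr2 := r.2
  split_ifs with hr
  · change z (t - ((p i : ℕ) : ℤ) + 1 + (((r : ℕ) + 1 : ℕ) : ℤ)) i
      = z (t + 1 - ((p i : ℕ) : ℤ) + 1 + ((r : ℕ) : ℤ)) i
    rw [show t - ((p i : ℕ) : ℤ) + 1 + (((r : ℕ) + 1 : ℕ) : ℤ)
      = t + 1 - ((p i : ℕ) : ℤ) + 1 + ((r : ℕ) : ℤ) by push_cast; ring]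
  · rw [inputLin_apply, PiLp.sub_apply, add_sub_cancel]
    change _ = z (t + 1 - ((p i : ℕ) : ℤ) + 1 + ((r : ℕ) : ℤ)) i
    rw [show t + 1 - ((p i : ℕ) : ℤ) + 1 + ((r : ℕ) : ℤ) = t + 1 by omega]

theorem keyEntries_stateLin (z : ℤ → Input m) (t : ℤ) : keyEntries p (stateLin p t z) = z t := by
  ext i
  change z (t - ((p i : ℕ) : ℤ) + 1 + (((p i : ℕ) - 1 : ℕ) : ℤ)) i = _
  have := (p i).pos
  rw [show t - ((p i : ℕ) : ℤ) + 1 + (((p i : ℕ) - 1 : ℕ) : ℤ) = t by omega]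

theorem IsCanonicalForm.keyEntries_step (h : IsCanonicalForm p A B) (x : State p) (u : Input m) :
    keyEntries p (A.toEuclideanLin x + B.toEuclideanLin u)
      = (keyRows p A).toEuclideanLin x + u := by
  ext i
  change (A.toEuclideanLin x + B.toEuclideanLin u) (lastIndex p i) = _
  rw [lastIndex, h.step_apply, dif_neg, PiLp.add_apply]
  have := (p i).pos
  simp only
  omega

/-- The states and inputs that apply `u_t = z_{t+1} - A(𝓘,:) x_t` from `x_0 = 0` are those
generated by the sequence `z`. -/
theorem IsCanonicalForm.eq_stateLin (h : IsCanonicalForm p A B) {x : ℕ → State p}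
    {u : ℕ → Input m} {z : ℤ → Input m} {N : ℕ} (hz : ∀ t ≤ 0, z t = 0) (hx0 : x 0 = 0)
    (hx : ∀ t, x (t + 1) = A.toEuclideanLin (x t) + B.toEuclideanLin (u t))
    (hu : ∀ t, t < N → u t = z (t + 1) - (keyRows p A).toEuclideanLin (x t)) :
    (∀ t : ℕ, t ≤ N → x t = stateLin p t z) ∧ ∀ t : ℕ, t < N → u t = inputLin A t z := by
  have hX : ∀ t : ℕ, t ≤ N → x t = stateLin p t z := by
    intro t
    induction t with
    | zero =>
      intro _
      rw [hx0, ← map_zero (stateLin p ((0 : ℕ) : ℤ))]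
      exact stateLin_congr fun k _ hk => (hz k hk).symm
    | succ t ih =>
      intro ht
      have h1 := ih (by omega)
      rw [hx t, h1, h.step_stateLin z t]
      · push_cast; rfl
      · rw [hu t (by omega), h1, inputLin_apply]
  exact ⟨hX, fun t ht => by rw [hu t ht, hX t ht.le, inputLin_apply]⟩

/-- On the trajectory generated by `(z_1, …, z_N)` the costs `J` and `C` agree. -/
theorem Problem.J_eq_C {S : Problem p} {x : ℕ → State p} {u : ℕ → Input m}
    (z : EuclideanSpace ℝ (Fin S.N × Fin m))
    (hx : ∀ t : ℕ, t ≤ S.N → x t = stateLin p t (extendLin m S.N z))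
    (hu : ∀ t : ℕ, t < S.N → u t = inputLin S.A t (extendLin m S.N z)) : S.J x u = S.C z := by
  have h1 : ∑ t ∈ Finset.range S.N, S.f t (x t)
      = ∑ t ∈ Finset.range S.N, S.fz t (extend S.N z) :=
    Finset.sum_congr rfl fun t ht => by rw [hx t (Finset.mem_range.1 ht).le]; rfl
  have h2 : ∑ t ∈ Finset.range S.N, S.g t (u t)
      = ∑ t ∈ Finset.range S.N, S.gz t (extend S.N z) :=
    Finset.sum_congr rfl fun t ht => by rw [hu t (Finset.mem_range.1 ht)]; rfl
  rw [Problem.J, Problem.C, Finset.sum_add_distrib, h1, h2, hx S.N le_rfl,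
    Finset.sum_range_succ]
  change _ + _ + S.fz S.N (extend S.N z) = _
  ring

theorem Problem.exists_J_eq_C {S : Problem p} (h : IsCanonicalForm p S.A S.B)
    {x : ℕ → State p} {u : ℕ → Input m} (hxu : S.IsTrajectory x u) :
    ∃ z, S.J x u = S.C z := by
  obtain ⟨z, hz⟩ := exists_extendLin_eq (m := m) (N := S.N)
    (z := fun t => if 1 ≤ t ∧ t ≤ (S.N : ℤ) then keyEntries p (x t.toNat) else 0)
    (fun t ht => if_neg ht)
  refine ⟨z, ?_⟩
  obtain ⟨h1, h2⟩ := h.eq_stateLin (x := x) (u := u) (z := extendLin m S.N z) (N := S.N)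
    (fun t ht => extendLin_of_not_mem (by omega) z) hxu.1 hxu.2 (by
      intro t ht
      have e : ((t : ℤ) + 1).toNat = t + 1 := by omega
      rw [hz]
      simp only
      rw [if_pos (by omega), e, hxu.2, h.keyEntries_step]
      abel)
  exact Problem.J_eq_C z h1 h2

theorem Problem.le_optimalCost {S : Problem p} (h : IsCanonicalForm p S.A S.B) {c : ℝ}
    (hc : ∀ z, c ≤ S.C z) : c ≤ S.optimalCost := by
  refine le_csInf ⟨_, 0, 0, ⟨rfl, fun t => by simp⟩, rfl⟩ ?_
  rintro _ ⟨x, u, hxu, rfl⟩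
  obtain ⟨z, hz⟩ := Problem.exists_J_eq_C h hxu
  rw [hz]
  exact hc z

/-- The cost of RHTM is the value of `C` at the `K`-th iterate of triple momentum. -/
theorem Problem.rhtm_J_eq_C {S : Problem p} (h : IsCanonicalForm p S.A S.B) (γ : Stepsizes)
    {W : ℕ} (hW : 1 ≤ W) (φ : ℕ → Input m) {z : EuclideanSpace ℝ (Fin S.N × Fin m)}
    (hz : extendLin m S.N z = momentumZ γ S.seqGrad (initialSeq S.N φ) (numUpdates p W)) :
    S.J (S.rhtmState γ W φ) (S.rhtmInput γ W φ) = S.C z := by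
  obtain ⟨h1, h2⟩ := h.eq_stateLin (x := S.rhtmState γ W φ) (u := S.rhtmInput γ W φ)
    (z := extendLin m S.N z) (N := S.N) (fun t ht => extendLin_of_not_mem (by omega) z) rfl
    (fun _ => rfl) (by
      intro t _
      rw [hz, ← S.memory_z γ hW φ t]
      rfl)
  exact Problem.J_eq_C z h1 h2

end Trajectories

/-! ### Bounds that depend on the system only -/

section Bounds

variable {m : ℕ} {p : Fin m → ℕ+}
  {A : Matrix (StateIndex p) (StateIndex p) ℝ} {B : Matrix (StateIndex p) (Fin m) ℝ}
  {Q : Matrix (StateIndex p) (StateIndex p) ℝ} {R : Matrix (Fin m) (Fin m) ℝ}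
  {P : Matrix (StateIndex p) (StateIndex p) ℝ}

theorem exists_norm_le {V V' : Type*} [NormedAddCommGroup V] [NormedSpace ℝ V]
    [NormedAddCommGroup V'] [NormedSpace ℝ V'] [FiniteDimensional ℝ V] (L : V →ₗ[ℝ] V') :
    ∃ c, 0 ≤ c ∧ ∀ v, ‖L v‖ ≤ c * ‖v‖ :=
  ⟨‖L.toContinuousLinearMap‖, norm_nonneg _, L.toContinuousLinearMap.le_opNorm⟩

theorem exists_coercive_of_posDef {ι : Type*} [Fintype ι] [DecidableEq ι] {M : Matrix ι ι ℝ}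
    (hM : M.PosDef) :
    ∃ q, 0 < q ∧ ∀ v : EuclideanSpace ℝ ι, q * ‖v‖ ^ 2 ≤ ⟪M.toEuclideanLin v, v⟫_ℝ := by
  have hpos : ∀ v : EuclideanSpace ℝ ι, v ≠ 0 → 0 < ⟪M.toEuclideanLin v, v⟫_ℝ := by
    intro v hv
    have := hM.dotProduct_mulVec_pos (x := v.ofLp) (by simpa using hv)
    rw [← quad_eq_inner]
    simpa [quad] using this
  rcases (Metric.sphere (0 : EuclideanSpace ℝ ι) 1).eq_empty_or_nonempty with he | hne
  · refine ⟨1, one_pos, fun v => ?_⟩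
    have hv : v = 0 := by
      by_contra hv
      have : (‖v‖⁻¹ • v) ∈ Metric.sphere (0 : EuclideanSpace ℝ ι) 1 := by
        simp [norm_smul, hv]
      rw [he] at this
      exact this
    simp [hv]
  · have hcont : Continuous fun v : EuclideanSpace ℝ ι => ⟪M.toEuclideanLin v, v⟫_ℝ :=
      (M.toEuclideanLin.continuous_of_finiteDimensional).inner continuous_id
    obtain ⟨w, hw, hmin⟩ := (isCompact_sphere (0 : EuclideanSpace ℝ ι) 1).exists_isMinOn hne
      hcont.continuousOn
    have hw1 : ‖w‖ = 1 := by simpa using hw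
    refine ⟨_, hpos w (by rintro rfl; simp at hw1), fun v => ?_⟩
    by_cases hv : v = 0
    · simp [hv]
    have hn : ‖v‖ ≠ 0 := norm_ne_zero_iff.2 hv
    have h := hmin (show (‖v‖⁻¹ • v) ∈ Metric.sphere (0 : EuclideanSpace ℝ ι) 1 by
      simp [norm_smul, hv])
    simp only [Set.mem_ofPred_eq, map_smul, inner_smul_left, inner_smul_right, conj_trivial] at h
    calc _ ≤ (‖v‖⁻¹ * (‖v‖⁻¹ * ⟪M.toEuclideanLin v, v⟫_ℝ)) * ‖v‖ ^ 2 := by gcongr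
      _ = _ := by field_simp

/-- The stage cost controls `z_{t+1}`, because `z_{t+1} = u_t + A(𝓘,:) x_t`. -/
theorem exists_stage_coercive (A : Matrix (StateIndex p) (StateIndex p) ℝ) (hQ : Q.PosDef)
    (hR : R.PosDef) : ∃ μ, 0 < μ ∧ ∀ (z : ℤ → Input m) (t : ℤ), μ * ‖z (t + 1)‖ ^ 2 ≤
      ⟪Q.toEuclideanLin (stateLin p t z), stateLin p t z⟫_ℝ +
        ⟪R.toEuclideanLin (inputLin A t z), inputLin A t z⟫_ℝ := by
  obtain ⟨q, hq, hq'⟩ := exists_coercive_of_posDef hQ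
  obtain ⟨r, hr, hr'⟩ := exists_coercive_of_posDef hR
  obtain ⟨a, ha, ha'⟩ := exists_norm_le (keyRows p A).toEuclideanLin
  refine ⟨1 / (2 / r + 2 * a ^ 2 / q), by positivity, fun z t => ?_⟩
  have hz : z (t + 1) = inputLin A t z + (keyRows p A).toEuclideanLin (stateLin p t z) := by
    rw [inputLin_apply]; abel
  have h1 := ha' (stateLin p t z)
  have h2 := hq' (stateLin p t z)
  have h3 := hr' (inputLin A t z)
  have h4 : ‖z (t + 1)‖ ≤ ‖inputLin A t z‖ + a * ‖stateLin p t z‖ := by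
    rw [hz]; exact (norm_add_le _ _).trans (by gcongr)
  generalize ‖stateLin p t z‖ = x at *
  generalize ‖inputLin A t z‖ = u at *
  have h5 : ‖z (t + 1)‖ ^ 2 ≤ 2 * u ^ 2 + 2 * a ^ 2 * x ^ 2 := by
    have := pow_le_pow_left₀ (norm_nonneg _) h4 2
    nlinarith [sq_nonneg (u - a * x)]
  rw [one_div, inv_mul_le_iff₀ (by positivity)]
  refine h5.trans ?_
  have h6 : 2 * u ^ 2 = 2 / r * (r * u ^ 2) := by field_simp
  have h7 : 2 * a ^ 2 * x ^ 2 = 2 * a ^ 2 / q * (q * x ^ 2) := by field_simp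
  have h8 : 0 ≤ q * x ^ 2 := by positivity
  have h9 : 0 ≤ r * u ^ 2 := by positivity
  rw [h6, h7, add_mul]
  gcongr <;> linarith

theorem exists_norm_inputLin_le (A : Matrix (StateIndex p) (StateIndex p) ℝ) :
    ∃ c, 0 ≤ c ∧ ∀ (t : ℤ) (z : ℤ → Input m) (b : ℝ), 0 ≤ b →
      (∀ k, t - controllabilityIndex p < k → k ≤ t + 1 → ‖z k‖ ≤ b) → ‖inputLin A t z‖ ≤ c * b := by
  obtain ⟨a, ha, ha'⟩ := exists_norm_le (keyRows p A).toEuclideanLin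
  refine ⟨1 + a * √(Fintype.card (StateIndex p)), by positivity, fun t z b hb h => ?_⟩
  have h1 := norm_stateLin_le (p := p) hb fun k h1 h2 => h k h1 (by omega)
  rw [inputLin_apply]
  calc _ ≤ ‖z (t + 1)‖ + ‖(keyRows p A).toEuclideanLin (stateLin p t z)‖ := norm_sub_le _ _
    _ ≤ b + a * (√(Fintype.card (StateIndex p)) * b) := by
      refine add_le_add (h _ (by omega) le_rfl) ((ha' _).trans ?_)
      gcongr
    _ = _ := by ring

end Bounds

/-! ### Optimal steady states -/

section Steady

variable {m : ℕ} {p : Fin m → ℕ+}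
  {A : Matrix (StateIndex p) (StateIndex p) ℝ} {B : Matrix (StateIndex p) (Fin m) ℝ}
  {Q : Matrix (StateIndex p) (StateIndex p) ℝ} {R : Matrix (Fin m) (Fin m) ℝ}
  {P : Matrix (StateIndex p) (StateIndex p) ℝ}

/-- Constant sequences. -/
def constLin (m : ℕ) : Input m →ₗ[ℝ] (ℤ → Input m) := LinearMap.pi fun _ => LinearMap.id

/-- The steady state with key entries `v`. -/
def steadyState (p : Fin m → ℕ+) : Input m →ₗ[ℝ] State p := stateLin p 0 ∘ₗ constLin m

/-- The input of the steady state with key entries `v`. -/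
def steadyInput (A : Matrix (StateIndex p) (StateIndex p) ℝ) : Input m →ₗ[ℝ] Input m :=
  inputLin A 0 ∘ₗ constLin m

theorem stateLin_const (t : ℤ) (v : Input m) : stateLin p t (constLin m v) = steadyState p v := rfl

theorem inputLin_const (t : ℤ) (v : Input m) : inputLin A t (constLin m v) = steadyInput A v := rfl

theorem IsCanonicalForm.steady_iff (h : IsCanonicalForm p A B) (x : State p) (u : Input m) :
    x = A.toEuclideanLin x + B.toEuclideanLin u ↔
      ∃ v, x = steadyState p v ∧ u = steadyInput A v := by
  constructor
  · intro hx
    have hx1 : x = steadyState p (keyEntries p x) := by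
      ext ⟨i, r⟩
      change x ⟨i, r⟩ = x (lastIndex p i)
      -- a steady state is constant on each block, by descent from the last entry
      have key : ∀ d : ℕ, ∀ r : Fin (p i : ℕ), (r : ℕ) + d + 1 = (p i : ℕ) →
          x ⟨i, r⟩ = x (lastIndex p i) := by
        intro d
        induction d with
        | zero =>
          intro r hr
          rw [show r = ⟨(p i : ℕ) - 1, Nat.sub_lt (p i).pos Nat.one_pos⟩ from
            Fin.ext (show (r : ℕ) = (p i : ℕ) - 1 by omega)]
          rfl
        | succ d ih =>
          intro r hr
          have hr' : (r : ℕ) + 1 < (p i : ℕ) := by omega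
          rw [hx, h.step_apply, dif_pos hr', ← hx]
          exact ih ⟨(r : ℕ) + 1, hr'⟩ (by simp only; omega)
      exact key ((p i : ℕ) - 1 - r) r (by have := r.2; omega)
    refine ⟨keyEntries p x, hx1, ?_⟩
    have h1 := h.keyEntries_step x u
    rw [← hx] at h1
    change u = keyEntries p x - (keyRows p A).toEuclideanLin (steadyState p (keyEntries p x))
    rw [← hx1, h1]
    abel
  · rintro ⟨v, rfl, rfl⟩
    have := h.step_stateLin (constLin m v) 0 rfl
    rw [stateLin_const, inputLin_const, stateLin_const] at this
    exact this.symm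

/-- First-order optimality of the steady state with key entries `v` for the reference `η`. -/
def IsStationary (A Q : Matrix (StateIndex p) (StateIndex p) ℝ) (R : Matrix (Fin m) (Fin m) ℝ)
    (v : Input m) (η : State p) : Prop :=
  ∀ w, ⟪Q.toEuclideanLin (steadyState p v - η), steadyState p w⟫_ℝ +
    ⟪R.toEuclideanLin (steadyInput A v), steadyInput A w⟫_ℝ = 0

theorem isStationary_zero : IsStationary A Q R (0 : Input m) (0 : State p) := by
  intro w; simp

theorem exists_norm_sub_le_of_isStationary (A : Matrix (StateIndex p) (StateIndex p) ℝ)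
    (hQ : Q.PosDef) (hR : R.PosDef) : ∃ c, 0 ≤ c ∧ ∀ (v v' : Input m) (η η' : State p),
      IsStationary A Q R v η → IsStationary A Q R v' η' → ‖v - v'‖ ≤ c * ‖η - η'‖ := by
  obtain ⟨μ, hμ, hμ'⟩ := exists_stage_coercive A hQ hR
  obtain ⟨a, ha, ha'⟩ := exists_norm_le Q.toEuclideanLin
  obtain ⟨b, hb, hb'⟩ := exists_norm_le (steadyState p)
  refine ⟨a * b / μ, by positivity, fun v v' η η' h h' => ?_⟩
  have h1 := hμ' (constLin m (v - v')) 0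
  rw [stateLin_const, inputLin_const] at h1
  have h2 := h (v - v')
  have h3 := h' (v - v')
  have h4 : ⟪Q.toEuclideanLin (steadyState p (v - v')), steadyState p (v - v')⟫_ℝ +
      ⟪R.toEuclideanLin (steadyInput A (v - v')), steadyInput A (v - v')⟫_ℝ
      = ⟪Q.toEuclideanLin (η - η'), steadyState p (v - v')⟫_ℝ := by
    generalize hw : v - v' = w at *
    have e1 : ⟪Q.toEuclideanLin (steadyState p w), steadyState p w⟫_ℝ
        = ⟪Q.toEuclideanLin (steadyState p v), steadyState p w⟫_ℝ
          - ⟪Q.toEuclideanLin (steadyState p v'), steadyState p w⟫_ℝ := by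
      rw [← inner_sub_left, ← map_sub, ← map_sub, hw]
    have e2 : ⟪R.toEuclideanLin (steadyInput A w), steadyInput A w⟫_ℝ
        = ⟪R.toEuclideanLin (steadyInput A v), steadyInput A w⟫_ℝ
          - ⟪R.toEuclideanLin (steadyInput A v'), steadyInput A w⟫_ℝ := by
      rw [← inner_sub_left, ← map_sub, ← map_sub, hw]
    rw [e1, e2]
    simp only [map_sub, inner_sub_left] at h2 h3 ⊢
    linarith
  rw [h4] at h1
  have h5 : ⟪Q.toEuclideanLin (η - η'), steadyState p (v - v')⟫_ℝ
      ≤ (a * ‖η - η'‖) * (b * ‖v - v'‖) :=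
    (real_inner_le_norm _ _).trans (mul_le_mul (ha' _) (hb' _) (norm_nonneg _) (by positivity))
  have h6 : μ * ‖v - v'‖ ^ 2 ≤ (a * ‖η - η'‖) * (b * ‖v - v'‖) := h1.trans h5
  rcases (norm_nonneg (v - v')).eq_or_lt with h0 | h0
  · rw [← h0]; positivity
  · rw [div_mul_eq_mul_div, le_div_iff₀ hμ]
    refine le_of_mul_le_mul_right ?_ h0
    calc _ = μ * ‖v - v'‖ ^ 2 := by ring
      _ ≤ _ := h6
      _ = _ := by ring

/-- The initialization FOSS satisfies the first-order condition of the steady-state problem. -/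
theorem isStationary_foss (hAB : IsCanonicalForm p A B) (hQ : Q.PosDef) (hR : R.PosDef) {N : ℕ}
    {θ : ℕ → State p} {t : ℕ} (ht : t < N) :
    IsStationary A Q R ((lqTracking A B Q R P N θ).foss t) (θ t) := by
  obtain ⟨μ, hμ, hμ'⟩ := exists_stage_coercive A hQ hR
  have hF := (isQuadratic_comp (Matrix.isSymmetric_toEuclideanLin_iff.2 hQ.isHermitian)
      (steadyState p) (θ t)).add
    (isQuadratic_comp (Matrix.isSymmetric_toEuclideanLin_iff.2 hR.isHermitian)
      (steadyInput A) 0)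
  have hcost : ∀ (x : State p) (u : Input m), (lqTracking A B Q R P N θ).f t x +
      (lqTracking A B Q R P N θ).g t u = 1 / 2 * ⟪Q.toEuclideanLin (x - θ t), x - θ t⟫_ℝ +
        1 / 2 * ⟪R.toEuclideanLin (u - 0), u - 0⟫_ℝ := by
    intro x u
    rw [lqTracking_g]
    simp only [lqTracking, if_pos ht, quad_eq_inner]
  have hT : ∀ w, μ * ‖w‖ ^ 2 ≤ ⟪(LinearMap.adjoint (steadyState p) ∘ₗ Q.toEuclideanLin ∘ₗ
      steadyState p + LinearMap.adjoint (steadyInput A) ∘ₗ R.toEuclideanLin ∘ₗ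
      steadyInput A) w, w⟫_ℝ := by
    intro w
    rw [LinearMap.add_apply, inner_add_left]
    simp only [LinearMap.comp_apply, LinearMap.adjoint_inner_left]
    exact hμ' (constLin m w) 0
  obtain ⟨v₀, hv₀⟩ := hF.exists_grad_eq_zero hμ hT
  have hex : ∃ e, (lqTracking A B Q R P N θ).IsOptimalSteadyState t e := by
    refine ⟨(steadyState p v₀, steadyInput A v₀),
      (hAB.steady_iff _ _).2 ⟨v₀, rfl, rfl⟩, fun x u hxu => ?_⟩
    obtain ⟨v, rfl, rfl⟩ := (hAB.steady_iff x u).1 hxu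
    rw [hcost, hcost]
    exact hF.le_of_grad_eq_zero hμ hT hv₀ v
  have hopt : (lqTracking A B Q R P N θ).IsOptimalSteadyState t
      ((lqTracking A B Q R P N θ).optimalSteadyState t) := Classical.epsilon_spec hex
  obtain ⟨v, hv1, hv2⟩ := (hAB.steady_iff _ _).1 hopt.1
  have hfoss : (lqTracking A B Q R P N θ).foss t = v := by
    rw [Problem.foss, hv1]
    exact keyEntries_stateLin (constLin m v) 0
  have hle := hopt.2 (steadyState p v₀) (steadyInput A v₀)
    ((hAB.steady_iff _ _).2 ⟨v₀, rfl, rfl⟩)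
  rw [hcost, hcost, hv1, hv2] at hle
  have hvv : v - v₀ = 0 := by
    have h1 := hF.eq_of_grad_eq_zero hv₀ v
    have h2 := hT (v - v₀)
    have h3 : μ * ‖v - v₀‖ ^ 2 ≤ 0 := by linarith
    have h4 : ‖v - v₀‖ ^ 2 ≤ 0 := by nlinarith [sq_nonneg ‖v - v₀‖]
    exact norm_eq_zero.1 (pow_eq_zero_iff (two_ne_zero) |>.1 (le_antisymm h4 (sq_nonneg _)))
  rw [hfoss, sub_eq_zero.1 hvv]
  intro w
  have := congrArg (fun g => ⟪g, w⟫_ℝ) hv₀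
  simpa only [inner_add_left, LinearMap.adjoint_inner_left, sub_zero, inner_zero_left] using this

end Steady

/-! ### The gradient of the objective at the initialization -/

section Gradient

variable {m : ℕ} {p : Fin m → ℕ+}
  {A : Matrix (StateIndex p) (StateIndex p) ℝ} {B : Matrix (StateIndex p) (Fin m) ℝ}
  {Q : Matrix (StateIndex p) (StateIndex p) ℝ} {R : Matrix (Fin m) (Fin m) ℝ}
  {P : Matrix (StateIndex p) (StateIndex p) ℝ} {N : ℕ} {θ : ℕ → State p}

/-- Shift invariance: the states generated by a single impulse add up to a steady state. -/
theorem sum_stateLin_single {I : Finset ℕ} {s : ℤ} (hs : 1 ≤ s)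
    (hI : ∀ t : ℕ, s ≤ t → (t : ℤ) ≤ s + controllabilityIndex p - 1 → t ∈ I) (v : Input m) :
    ∑ t ∈ I, stateLin p t (Pi.single s v) = steadyState p v := by
  ext ⟨i, r⟩
  rw [WithLp.ofLp_sum, Finset.sum_apply]
  change ∑ t ∈ I, (Pi.single s v : ℤ → Input m)
    ((t : ℤ) - ((p i : ℕ) : ℤ) + 1 + ((r : ℕ) : ℤ)) i = v i
  have hr := r.2
  have hp := le_controllabilityIndex p i
  rw [Finset.sum_eq_single (s + (p i : ℕ) - 1 - (r : ℕ)).toNat]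
  · rw [show (((s + (p i : ℕ) - 1 - (r : ℕ)).toNat : ℕ) : ℤ) - ((p i : ℕ) : ℤ) + 1 +
      ((r : ℕ) : ℤ) = s by omega, Pi.single_eq_same]
  · intro t _ ht
    rw [Pi.single_eq_of_ne (by omega)]
    rfl
  · intro h
    exact absurd (hI _ (by omega) (by omega)) h

theorem sum_inputLin_single {I : Finset ℕ} {s : ℤ} (hs : 1 ≤ s)
    (hI : ∀ t : ℕ, s - 1 ≤ t → (t : ℤ) ≤ s + controllabilityIndex p - 1 → t ∈ I) (v : Input m) :
    ∑ t ∈ I, inputLin A t (Pi.single s v) = steadyInput A v := by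
  simp only [inputLin_apply]
  rw [Finset.sum_sub_distrib, ← map_sum, sum_stateLin_single hs fun t h1 h2 => hI t (by omega) h2,
    Finset.sum_eq_single (s - 1).toNat]
  · rw [show (((s - 1).toNat : ℕ) : ℤ) + 1 = s by omega, Pi.single_eq_same]
    rfl
  · intro t _ ht
    rw [Pi.single_eq_of_ne (by omega)]
  · intro h
    exact absurd (hI _ (by omega) (by omega)) h

theorem norm_single_le (s k : ℤ) (v : Input m) : ‖(Pi.single s v : ℤ → Input m) k‖ ≤ ‖v‖ := by
  by_cases h : k = s
  · subst h; simp
  · simp [Pi.single_eq_of_ne h]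

theorem card_filter_window_le (I : Finset ℕ) (a b : ℤ) (n : ℕ) (hn : b - a < n) :
    (I.filter fun t : ℕ => a ≤ (t : ℤ) ∧ (t : ℤ) ≤ b).card ≤ n := by
  have h1 : (I.filter fun t : ℕ => a ≤ (t : ℤ) ∧ (t : ℤ) ≤ b).card ≤ (Finset.Icc a b).card :=
    Finset.card_le_card_of_injOn (fun t : ℕ => (t : ℤ))
      (fun t ht => by simpa using (Finset.mem_filter.1 (Finset.mem_coe.1 ht)).2)
      (fun x _ y _ h => Nat.cast_injective h)
  rw [Int.card_Icc] at h1
  omega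

/-- The partial gradient is Lipschitz: it is small at stage `s` if the variables and the reference
are close to a constant pair `(v, η)` for which it vanishes. -/
theorem exists_norm_partialC_le (A B : Matrix _ _ ℝ) (hQ : Q.IsHermitian) (hR : R.IsHermitian)
    (hP : P.IsHermitian) : ∃ c, 0 ≤ c ∧ ∀ (N : ℕ) (θ : ℕ → State p) (s : ℤ) (z : ℤ → Input m)
      (b : ℝ) (v : Input m) (η : State p), 0 ≤ b →
      (∀ w, (∑ t ∈ (Finset.range (N + 1)).filter (fun t : ℕ =>
            s ≤ (t : ℤ) ∧ (t : ℤ) ≤ s + (controllabilityIndex p : ℤ) - 1),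
          ⟪weight Q P N t (steadyState p v - η), stateLin p t (Pi.single s w)⟫_ℝ) +
        (∑ t ∈ (Finset.range N).filter (fun t : ℕ =>
            s - 1 ≤ (t : ℤ) ∧ (t : ℤ) ≤ s + (controllabilityIndex p : ℤ) - 1),
          ⟪R.toEuclideanLin (steadyInput A v), inputLin A t (Pi.single s w)⟫_ℝ) = 0) →
      (∀ k, s - controllabilityIndex p ≤ k → k ≤ s + controllabilityIndex p → ‖z k - v‖ ≤ b) →
      (∀ t : ℕ, s ≤ t → (t : ℤ) ≤ s + controllabilityIndex p - 1 → ‖target N θ t - η‖ ≤ b) →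
      ‖(lqTracking A B Q R P N θ).partialC s z‖ ≤ c * b := by
  obtain ⟨q, hq, hq'⟩ := exists_norm_le Q.toEuclideanLin
  obtain ⟨e, he, he'⟩ := exists_norm_le P.toEuclideanLin
  obtain ⟨r, hr, hr'⟩ := exists_norm_le R.toEuclideanLin
  obtain ⟨a, ha, ha'⟩ := exists_norm_inputLin_le A
  set κ : ℝ := √(Fintype.card (StateIndex p)) with hκ
  have hκ0 : 0 ≤ κ := Real.sqrt_nonneg _
  set n : ℕ := controllabilityIndex p with hn
  refine ⟨n * ((q + e) * (κ + 1) * κ) + (n + 1) * (r * a * a), by positivity, ?_⟩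
  intro N θ s z b v η hb h0 hz hθ
  set g := (lqTracking A B Q R P N θ).partialC s z with hg
  have hw : ∀ t x, ‖weight Q P N t x‖ ≤ (q + e) * ‖x‖ := by
    intro t x
    have := norm_nonneg x
    unfold weight
    split_ifs
    · exact (hq' x).trans (by gcongr; linarith)
    · exact (he' x).trans (by gcongr; linarith)
  have key : ⟪g, g⟫_ℝ ≤ (n * ((q + e) * (κ + 1) * κ) + (n + 1) * (r * a * a)) * b * ‖g‖ := by
    have h1 := inner_partialC (A := A) (B := B) (N := N) (θ := θ) hQ hR hP s z g
    rw [← hg] at h1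
    have h2 := h0 g
    rw [h1, ← sub_zero (_ + _), ← h2, add_sub_add_comm, ← Finset.sum_sub_distrib,
      ← Finset.sum_sub_distrib]
    simp only [← inner_sub_left, ← map_sub]
    have hb1 : ∀ t ∈ (Finset.range (N + 1)).filter (fun t : ℕ =>
        s ≤ (t : ℤ) ∧ (t : ℤ) ≤ s + (n : ℤ) - 1),
        ⟪weight Q P N t (stateLin p t z - target N θ t - (steadyState p v - η)),
          stateLin p t (Pi.single s g)⟫_ℝ ≤ (q + e) * (κ + 1) * κ * b * ‖g‖ := by
      intro t ht
      have ht := (Finset.mem_filter.1 ht).2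
      have e1 : ‖stateLin p t z - target N θ t - (steadyState p v - η)‖ ≤ (κ + 1) * b := by
        have : stateLin p t z - target N θ t - (steadyState p v - η)
            = stateLin p t (z - constLin m v) - (target N θ t - η) := by
          rw [map_sub, stateLin_const]; abel
        rw [this]
        have e2 : ‖stateLin p t (z - constLin m v)‖ ≤ κ * b :=
          norm_stateLin_le hb fun k h1 h2 => hz k (by omega) (by omega)
        have e3 := hθ t ht.1 ht.2
        calc _ ≤ _ := norm_sub_le _ _
          _ ≤ κ * b + b := add_le_add e2 e3
          _ = _ := by ring
      have e4 : ‖stateLin p t (Pi.single s g)‖ ≤ κ * ‖g‖ :=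
        norm_stateLin_le (norm_nonneg g) fun k _ _ => norm_single_le s k g
      calc _ ≤ _ := real_inner_le_norm _ _
        _ ≤ ((q + e) * ((κ + 1) * b)) * (κ * ‖g‖) :=
          mul_le_mul ((hw t _).trans (by gcongr)) e4 (norm_nonneg _) (by positivity)
        _ = _ := by ring
    have hb2 : ∀ t ∈ (Finset.range N).filter (fun t : ℕ =>
        s - 1 ≤ (t : ℤ) ∧ (t : ℤ) ≤ s + (n : ℤ) - 1),
        ⟪R.toEuclideanLin (inputLin A t z - steadyInput A v),
          inputLin A t (Pi.single s g)⟫_ℝ ≤ r * a * a * b * ‖g‖ := by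
      intro t ht
      have ht := (Finset.mem_filter.1 ht).2
      have e1 : ‖inputLin A t z - steadyInput A v‖ ≤ a * b := by
        rw [← inputLin_const (A := A) t v, ← map_sub]
        exact ha' t _ b hb fun k h1 h2 => hz k (by omega) (by omega)
      have e4 : ‖inputLin A t (Pi.single s g)‖ ≤ a * ‖g‖ :=
        ha' t _ _ (norm_nonneg g) fun k _ _ => norm_single_le s k g
      calc _ ≤ _ := real_inner_le_norm _ _
        _ ≤ (r * (a * b)) * (a * ‖g‖) :=
          mul_le_mul ((hr' _).trans (by gcongr)) e4 (norm_nonneg _) (by positivity)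
        _ = _ := by ring
    have hc1 : (((Finset.range (N + 1)).filter (fun t : ℕ =>
        s ≤ (t : ℤ) ∧ (t : ℤ) ≤ s + (n : ℤ) - 1)).card : ℝ) ≤ n := by
      exact_mod_cast card_filter_window_le _ _ _ _ (by omega)
    have hc2 : (((Finset.range N).filter (fun t : ℕ =>
        s - 1 ≤ (t : ℤ) ∧ (t : ℤ) ≤ s + (n : ℤ) - 1)).card : ℝ) ≤ n + 1 := by
      exact_mod_cast card_filter_window_le _ _ _ _ (by push_cast; omega)
    have hs1 := Finset.sum_le_card_nsmul _ _ _ hb1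
    have hs2 := Finset.sum_le_card_nsmul _ _ _ hb2
    rw [nsmul_eq_mul] at hs1 hs2
    have hs3 := mul_le_mul_of_nonneg_right hc1
      (show 0 ≤ (q + e) * (κ + 1) * κ * b * ‖g‖ by positivity)
    have hs4 := mul_le_mul_of_nonneg_right hc2 (show 0 ≤ r * a * a * b * ‖g‖ by positivity)
    calc _ ≤ _ := add_le_add (hs1.trans hs3) (hs2.trans hs4)
      _ = _ := by ring
  rw [real_inner_self_eq_norm_sq] at key
  rcases (norm_nonneg g).eq_or_lt with h | h
  · rw [← h]; positivity
  · exact le_of_mul_le_mul_right (by rw [← sq]; exact key) h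

/-- The variation of the reference in the window `[s - n, s + n]`. -/
def windowVariation (N : ℕ) (θ : ℕ → State p) (n : ℕ) (s : ℤ) : ℝ :=
  ∑ k ∈ Finset.Icc (s - n) (s + n), ‖target N θ k - target N θ (k - 1)‖

theorem norm_sub_le_sum_Ioc {V : Type*} [NormedAddCommGroup V] (f : ℤ → V) {a b : ℤ}
    (hab : a ≤ b) : ‖f b - f a‖ ≤ ∑ k ∈ Finset.Ioc a b, ‖f k - f (k - 1)‖ := by
  induction b, hab using Int.leInduction with
  | base => simp
  | succ b hab ih =>
    have : Finset.Ioc a (b + 1) = insert (b + 1) (Finset.Ioc a b) := by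
      ext k; simp only [Finset.mem_Ioc, Finset.mem_insert]; omega
    rw [this, Finset.sum_insert (by simp), add_sub_cancel_right]
    calc _ = ‖(f (b + 1) - f b) + (f b - f a)‖ := by congr 1; abel
      _ ≤ _ := (norm_add_le _ _).trans (by gcongr)

theorem norm_target_sub_le (N : ℕ) (θ : ℕ → State p) {n : ℕ} {s a b : ℤ}
    (ha : s - n - 1 ≤ a) (ha' : a ≤ s + n) (hb : s - n - 1 ≤ b) (hb' : b ≤ s + n) :
    ‖target N θ a - target N θ b‖ ≤ windowVariation N θ n s := by
  wlog hab : b ≤ a generalizing a b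
  · rw [norm_sub_rev]
    exact this hb hb' ha ha' (by omega)
  refine (norm_sub_le_sum_Ioc _ hab).trans ?_
  refine Finset.sum_le_sum_of_subset_of_nonneg (fun k hk => ?_) fun _ _ _ => norm_nonneg _
  rw [Finset.mem_Ioc] at hk
  rw [Finset.mem_Icc]
  omega

theorem windowVariation_nonneg (N : ℕ) (θ : ℕ → State p) (n : ℕ) (s : ℤ) :
    0 ≤ windowVariation N θ n s := Finset.sum_nonneg fun _ _ => norm_nonneg _

theorem isStationary_initialSeq (hAB : IsCanonicalForm p A B) (hQ : Q.PosDef) (hR : R.PosDef)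
    (k : ℤ) : IsStationary A Q R
      (initialSeq N (lqTracking A B Q R P N θ).foss k) (target N θ (k - 1)) := by
  unfold initialSeq target
  by_cases h : 1 ≤ k ∧ k ≤ (N : ℤ)
  · rw [if_pos h, if_pos (by omega)]
    exact isStationary_foss hAB hQ hR (by omega)
  · rw [if_neg h, if_neg (by omega)]
    exact isStationary_zero

/-- At the initialization FOSS each partial gradient is bounded by the variation of the reference
nearby. -/
theorem exists_norm_partialC_foss_le (hAB : IsCanonicalForm p A B) (hQ : Q.PosDef)
    (hR : R.PosDef) (hP : P.PosSemidef) : ∃ c, 0 ≤ c ∧ ∀ (N : ℕ) (θ : ℕ → State p) (s : ℤ),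
      1 ≤ s → s ≤ N → ‖(lqTracking A B Q R P N θ).partialC s
        (initialSeq N (lqTracking A B Q R P N θ).foss)‖
          ≤ c * windowVariation N θ (controllabilityIndex p) s := by
  obtain ⟨c, hc, hc'⟩ := exists_norm_partialC_le A B hQ.isHermitian hR.isHermitian hP.isHermitian
  obtain ⟨L, hL, hL'⟩ := exists_norm_sub_le_of_isStationary A hQ hR
  refine ⟨c * (1 + L), by positivity, fun N θ s hs hsN' => ?_⟩
  have hV := windowVariation_nonneg N θ (controllabilityIndex p) s
  have hst := isStationary_initialSeq (P := P) (N := N) (θ := θ) hAB hQ hR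
  set V := windowVariation N θ (controllabilityIndex p) s with hVdef
  rw [mul_assoc]
  by_cases hsN : s + controllabilityIndex p - 1 < N
  · -- away from the horizon the gradient vanishes at the optimal steady state
    refine hc' N θ s _ _ (initialSeq N (lqTracking A B Q R P N θ).foss (s + 1))
      (target N θ s) (by positivity) ?_ ?_ ?_
    · intro w
      have h1 := hst (s + 1) w
      rw [add_sub_cancel_right] at h1
      rw [← h1]
      congr 1
      · rw [← sum_stateLin_single (I := (Finset.range (N + 1)).filter (fun t : ℕ =>
          s ≤ (t : ℤ) ∧ (t : ℤ) ≤ s + (controllabilityIndex p : ℤ) - 1)) hs (fun t h1 h2 => by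
            simp only [Finset.mem_filter, Finset.mem_range]; omega) w, inner_sum]
        refine Finset.sum_congr rfl fun t ht => ?_
        have ht := (Finset.mem_filter.1 ht).2
        rw [weight, if_pos (by omega)]
      · rw [← sum_inputLin_single (I := (Finset.range N).filter (fun t : ℕ =>
          s - 1 ≤ (t : ℤ) ∧ (t : ℤ) ≤ s + (controllabilityIndex p : ℤ) - 1)) hs (fun t h1 h2 => by
            simp only [Finset.mem_filter, Finset.mem_range]; omega) w, inner_sum]
    · intro k h1 h2
      have h3 := hL' _ _ _ _ (hst k) (hst (s + 1))
      have h4 := norm_target_sub_le N θ (n := controllabilityIndex p) (s := s) (a := k - 1)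
        (b := s + 1 - 1) (by omega) (by omega) (by omega) (by omega)
      calc _ ≤ _ := h3
        _ ≤ L * V := by gcongr
        _ ≤ _ := by gcongr; linarith
    · intro t h1 h2
      have h4 := norm_target_sub_le N θ (n := controllabilityIndex p) (s := s) (a := t)
        (b := s) (by omega) (by omega) (by omega) (by omega)
      calc _ ≤ _ := h4
        _ = 1 * V := (one_mul _).symm
        _ ≤ _ := by gcongr; linarith
  · -- near the horizon the reference is close to its final value `0`
    have h0 : target N θ N = 0 := if_neg (by omega)
    have h0' : initialSeq N (lqTracking A B Q R P N θ).foss ((N : ℤ) + 1) = 0 :=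
      if_neg (by omega)
    refine hc' N θ s _ _ 0 0 (by positivity) (fun w => by simp) ?_ ?_
    · intro k h1 h2
      have h3 := hL' _ _ _ _ (hst k) (hst (N + 1))
      have h4 := norm_target_sub_le N θ (n := controllabilityIndex p) (s := s) (a := k - 1)
        (b := (N : ℤ) + 1 - 1) (by omega) (by omega) (by omega) (by omega)
      rw [h0'] at h3
      calc _ ≤ _ := h3
        _ ≤ L * V := by gcongr
        _ ≤ _ := by gcongr; linarith
    · intro t h1 h2
      have h4 := norm_target_sub_le N θ (n := controllabilityIndex p) (s := s) (a := t)
        (b := N) (by omega) (by omega) (by omega) (by omega)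
      rw [h0] at h4
      calc _ ≤ _ := h4
        _ = 1 * V := (one_mul _).symm
        _ ≤ _ := by gcongr; linarith

end Gradient

/-! ### The regret of the initialization and of RHTM -/

section Regret

variable {m : ℕ} {p : Fin m → ℕ+}
  {A : Matrix (StateIndex p) (StateIndex p) ℝ} {B : Matrix (StateIndex p) (Fin m) ℝ}
  {Q : Matrix (StateIndex p) (StateIndex p) ℝ} {R : Matrix (Fin m) (Fin m) ℝ}
  {P : Matrix (StateIndex p) (StateIndex p) ℝ} {N : ℕ} {θ : ℕ → State p}

theorem pathVariation_eq (hN : θ N = 0) : pathVariation N θ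
    = ∑ t ∈ Finset.range (N + 1), ‖target N θ t - target N θ (t - 1)‖ := by
  have htgt : ∀ t : ℕ, t ≤ N → target N θ t = θ t := by
    intro t ht
    unfold target
    split_ifs with h
    · simp
    · rw [show t = N by omega, hN]
  refine Finset.sum_congr rfl fun t ht => ?_
  have ht := Finset.mem_range.1 ht
  rw [htgt t (by omega)]
  congr 2
  split_ifs with h
  · subst h
    rw [target, if_neg (by simp)]
  · rw [← htgt (t - 1) (by omega), Nat.cast_sub (by omega), Nat.cast_one]

theorem sum_window_sq_eq (N : ℕ) (θ : ℕ → State p) (n : ℕ) (s : ℤ) :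
    ∑ k ∈ Finset.Icc (s - n) (s + n), ‖target N θ k - target N θ (k - 1)‖ ^ 2
      = ∑ t ∈ Finset.range (N + 1), if s - n ≤ (t : ℤ) ∧ (t : ℤ) ≤ s + n then
        ‖target N θ t - target N θ (t - 1)‖ ^ 2 else 0 := by
  rw [← Finset.sum_filter]
  have h1 := Finset.sum_map ((Finset.range (N + 1)).filter fun t : ℕ =>
    s - n ≤ (t : ℤ) ∧ (t : ℤ) ≤ s + n) Nat.castEmbedding
    (fun k : ℤ => ‖target N θ k - target N θ (k - 1)‖ ^ 2)
  simp only [Nat.castEmbedding_apply] at h1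
  rw [← h1]
  symm
  refine Finset.sum_subset (fun k hk => ?_) fun k hk hk' => ?_
  · obtain ⟨t, ht, rfl⟩ := Finset.mem_map.1 hk
    rw [Finset.mem_Icc]
    exact (Finset.mem_filter.1 ht).2
  · have hk0 : ¬ (0 ≤ k ∧ k ≤ N) := by
      rintro ⟨h0, hN⟩
      refine hk' (Finset.mem_map.2 ⟨k.toNat, ?_, by simp [h0]⟩)
      rw [Finset.mem_filter, Finset.mem_range]
      rw [Finset.mem_Icc] at hk
      omega
    have h2 : target N θ k = 0 := if_neg (by omega)
    have h3 : target N θ (k - 1) = 0 := if_neg (by omega)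
    rw [h2, h3, sub_zero, norm_zero, zero_pow two_ne_zero]

theorem norm_target_le {b : ℝ} (hθ : ∀ t, t ≤ N → ‖θ t‖ ≤ b) (k : ℤ) : ‖target N θ k‖ ≤ b := by
  unfold target
  split_ifs with h
  · exact hθ _ (by omega)
  · rw [norm_zero]
    exact (norm_nonneg _).trans (hθ 0 (Nat.zero_le _))

theorem sum_windowVariation_sq_le {b : ℝ} (hθ : ∀ t, t ≤ N → ‖θ t‖ ≤ b) (hN : θ N = 0) (n : ℕ) :
    ∑ k ∈ Finset.range N, windowVariation N θ n ((k : ℤ) + 1) ^ 2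
      ≤ (2 * n + 1) ^ 2 * (2 * b) * pathVariation N θ := by
  have hd : ∀ t : ℤ, ‖target N θ t - target N θ (t - 1)‖ ^ 2
      ≤ 2 * b * ‖target N θ t - target N θ (t - 1)‖ := by
    intro t
    have h1 := norm_sub_le (target N θ t) (target N θ (t - 1))
    have h2 := norm_target_le hθ t
    have h3 := norm_target_le hθ (t - 1)
    rw [sq]
    gcongr
    linarith
  have h1 : ∀ s : ℤ, windowVariation N θ n s ^ 2 ≤ (2 * n + 1) *
      ∑ t ∈ Finset.range (N + 1), if s - n ≤ (t : ℤ) ∧ (t : ℤ) ≤ s + n then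
        ‖target N θ t - target N θ (t - 1)‖ ^ 2 else 0 := by
    intro s
    rw [← sum_window_sq_eq N θ n s]
    refine sq_sum_le_card_mul_sum_sq.trans (le_of_eq ?_)
    congr 1
    rw [Int.card_Icc, show (s + (n : ℤ) + 1 - (s - n)).toNat = 2 * n + 1 by omega]
    push_cast
    ring
  -- each term of the path variation is counted in at most `2 n + 1` windows
  have h2 : ∀ t : ℕ, (∑ k ∈ Finset.range N,
      if (k : ℤ) + 1 - n ≤ (t : ℤ) ∧ (t : ℤ) ≤ (k : ℤ) + 1 + n then
        ‖target N θ t - target N θ (t - 1)‖ ^ 2 else 0)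
      ≤ (2 * n + 1) * (2 * b * ‖target N θ t - target N θ (t - 1)‖) := by
    intro t
    rw [← Finset.sum_filter, Finset.sum_const, nsmul_eq_mul]
    have hc := card_filter_window_le (Finset.range N) ((t : ℤ) - 1 - n) ((t : ℤ) - 1 + n)
      (2 * n + 1) (by push_cast; omega)
    have hf : (Finset.range N).filter (fun k : ℕ => (k : ℤ) + 1 - n ≤ (t : ℤ) ∧
        (t : ℤ) ≤ (k : ℤ) + 1 + n) = (Finset.range N).filter (fun k : ℕ =>
          (t : ℤ) - 1 - n ≤ (k : ℤ) ∧ (k : ℤ) ≤ (t : ℤ) - 1 + n) :=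
      Finset.filter_congr fun k _ => by omega
    rw [hf]
    have hc' : (((Finset.range N).filter (fun k : ℕ =>
          (t : ℤ) - 1 - n ≤ (k : ℤ) ∧ (k : ℤ) ≤ (t : ℤ) - 1 + n)).card : ℝ) ≤ 2 * n + 1 := by
      exact_mod_cast hc
    exact mul_le_mul hc' (hd t) (by positivity) (by positivity)
  calc _ ≤ ∑ k ∈ Finset.range N, (2 * n + 1) * ∑ t ∈ Finset.range (N + 1),
        (if (k : ℤ) + 1 - n ≤ (t : ℤ) ∧ (t : ℤ) ≤ (k : ℤ) + 1 + n then
          ‖target N θ t - target N θ (t - 1)‖ ^ 2 else 0 : ℝ) :=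
        Finset.sum_le_sum fun k _ => h1 _
    _ = (2 * n + 1) * ∑ t ∈ Finset.range (N + 1), ∑ k ∈ Finset.range N,
        (if (k : ℤ) + 1 - n ≤ (t : ℤ) ∧ (t : ℤ) ≤ (k : ℤ) + 1 + n then
          ‖target N θ t - target N θ (t - 1)‖ ^ 2 else 0 : ℝ) := by
        rw [← Finset.mul_sum, Finset.sum_comm]
    _ ≤ (2 * n + 1) * ∑ t ∈ Finset.range (N + 1),
        (2 * n + 1) * (2 * b * ‖target N θ t - target N θ (t - 1)‖) := by
        gcongr with t _
        exact h2 t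
    _ = _ := by
        rw [pathVariation_eq hN, ← Finset.mul_sum, ← Finset.mul_sum]
        ring

/-- The Hessian of `C` is bounded below uniformly in the horizon. -/
theorem exists_hessian_coercive (A : Matrix (StateIndex p) (StateIndex p) ℝ) (hQ : Q.PosDef)
    (hR : R.PosDef) (hP : P.PosSemidef) : ∃ μ, 0 < μ ∧
      ∀ (N : ℕ) (w : EuclideanSpace ℝ (Fin N × Fin m)), μ * ‖w‖ ^ 2 ≤
        (∑ t ∈ Finset.range (N + 1), ⟪weight Q P N t (stateLin p t (extendLin m N w)),
          stateLin p t (extendLin m N w)⟫_ℝ) +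
        ∑ t ∈ Finset.range N, ⟪R.toEuclideanLin (inputLin A t (extendLin m N w)),
          inputLin A t (extendLin m N w)⟫_ℝ := by
  obtain ⟨μ, hμ, hμ'⟩ := exists_stage_coercive A hQ hR
  refine ⟨μ, hμ, fun N w => ?_⟩
  have hterm : 0 ≤ ⟪weight Q P N N (stateLin p N (extendLin m N w)),
      stateLin p N (extendLin m N w)⟫_ℝ := by
    rw [weight, if_neg (lt_irrefl N)]
    exact ((Matrix.isPositive_toEuclideanLin_iff.2 hP).re_inner_nonneg_left _)
  rw [Finset.sum_range_succ, norm_sq_eq_sum_extendLin, Finset.mul_sum]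
  have h1 : ∑ t ∈ Finset.range N, μ * ‖extendLin m N w ((t : ℤ) + 1)‖ ^ 2 ≤
      ∑ t ∈ Finset.range N, (⟪weight Q P N t (stateLin p t (extendLin m N w)),
          stateLin p t (extendLin m N w)⟫_ℝ +
        ⟪R.toEuclideanLin (inputLin A t (extendLin m N w)),
          inputLin A t (extendLin m N w)⟫_ℝ) := by
    refine Finset.sum_le_sum fun t ht => ?_
    rw [weight, if_pos (Finset.mem_range.1 ht)]
    exact hμ' _ _
  rw [Finset.sum_add_distrib] at h1
  linarith

end Regret

end RHTM

end

open RHTM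
theorem corollary1 {m : ℕ} (p : Fin m → ℕ+)
    (A : Matrix (StateIndex p) (StateIndex p) ℝ) (B : Matrix (StateIndex p) (Fin m) ℝ)
    (hAB : IsCanonicalForm p A B)
    (Q : Matrix (StateIndex p) (StateIndex p) ℝ) (R : Matrix (Fin m) (Fin m) ℝ)
    (hQ : Q.PosDef) (hR : R.PosDef)
    (P : Matrix (StateIndex p) (StateIndex p) ℝ) (hP : IsDARESolution A B Q R P)
    (θbar : ℝ) :
    ∃ c : ℝ, ∀ (N W : ℕ) (θ : ℕ → State p) (μ l : ℝ),
      1 ≤ W →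
      (∀ t, t ≤ N → ‖θ t‖ ≤ θbar) →
      θ N = 0 →
      0 < μ → μ ≤ l →
      StrongConvexOn Set.univ μ (lqTracking A B Q R P N θ).C →
      IsSmooth l (lqTracking A B Q R P N θ).C →
      (lqTracking A B Q R P N θ).regretRHTM (tripleMomentumStepsizes μ l) W
          (lqTracking A B Q R P N θ).foss ≤
        c * ((l / μ) ^ 2 * ((√(l / μ) - 1) / √(l / μ)) ^ (2 * numUpdates p W) *
          pathVariation N θ) := by
  obtain ⟨ν, hν, hν'⟩ := exists_hessian_coercive A hQ hR hP.1
  obtain ⟨a, ha, ha'⟩ := exists_norm_partialC_foss_le hAB hQ hR hP.1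
  refine ⟨5 * (a ^ 2 * ((2 * controllabilityIndex p + 1) ^ 2 * (2 * θbar)) / (2 * ν)), ?_⟩
  intro N W θ μ l hW hθ hN hμ hμl hconv hsmooth
  obtain ⟨G, T, hF, hG, hT⟩ :=
    exists_isQuadratic_C (A := A) (B := B) (N := N) (θ := θ) hQ.isHermitian hR.isHermitian
      hP.1.isHermitian
  have hTμ : ∀ w : EuclideanSpace ℝ (Fin N × Fin m), μ * ‖w‖ ^ 2 ≤ inner ℝ (T w) w :=
    hF.le_inner_of_strongConvexOn (μ := μ) hconv
  have hTl : ∀ w : EuclideanSpace ℝ (Fin N × Fin m), ‖T w‖ ≤ l * ‖w‖ :=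
    hF.norm_le_of_isSmooth (l := l) hsmooth
  have hTν : ∀ w, ν * ‖w‖ ^ 2 ≤ inner ℝ (T w) w := fun w => (hν' N w).trans_eq (hT w).symm
  obtain ⟨x, hx⟩ : ∃ x : EuclideanSpace ℝ (Fin N × Fin m), G x = 0 :=
    hF.exists_grad_eq_zero hμ hTμ
  obtain ⟨z₀, hz₀⟩ := exists_extendLin_eq (N := N)
    (z := initialSeq N (lqTracking A B Q R P N θ).foss) (fun t ht => if_neg ht)
  have hmin : ∀ z : EuclideanSpace ℝ (Fin N × Fin m),
      (lqTracking A B Q R P N θ).C x ≤ (lqTracking A B Q R P N θ).C z :=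
    hF.le_of_grad_eq_zero hμ hTμ hx
  have hopt : (lqTracking A B Q R P N θ).C x ≤ (lqTracking A B Q R P N θ).optimalCost :=
    Problem.le_optimalCost hAB hmin
  have hJ := Problem.rhtm_J_eq_C (S := lqTracking A B Q R P N θ) hAB
    (tripleMomentumStepsizes μ l) hW (lqTracking A B Q R P N θ).foss
    (z := momentumZ (tripleMomentumStepsizes μ l) G z₀ (numUpdates p W)) (by
      have h := momentumZ_map (tripleMomentumStepsizes μ l) (extendLin m N)
        (G := G) (G' := (lqTracking A B Q R P N θ).seqGrad) hG z₀ (numUpdates p W)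
      rw [hz₀] at h
      exact h.symm)
  have hsub := momentumZ_suboptimality_le hF hμ hμl hTμ hTl hx z₀ (numUpdates p W)
  -- the suboptimality of the initialization, from the size of the gradient there
  have hgrad : ‖G z₀‖ ^ 2 ≤ a ^ 2 * ((2 * controllabilityIndex p + 1) ^ 2 * (2 * θbar)
      * pathVariation N θ) := by
    rw [norm_sq_eq_sum_extendLin, hG, hz₀]
    refine le_trans ?_ (mul_le_mul_of_nonneg_left
      (sum_windowVariation_sq_le hθ hN (controllabilityIndex p)) (sq_nonneg a))
    rw [Finset.mul_sum]
    refine Finset.sum_le_sum fun k hk => ?_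
    have hk := Finset.mem_range.1 hk
    beta_reduce
    rw [if_pos (by omega), ← mul_pow]
    exact pow_le_pow_left₀ (norm_nonneg _) (ha' N θ _ (by omega) (by omega)) 2
  have hinit := hF.sub_le_norm_grad_sq hν hTν z₀ x
  have hζ : 1 ≤ l / μ := by rwa [one_le_div hμ]
  have hs : 0 < √(l / μ) := Real.sqrt_pos.2 (by linarith)
  have hρ : (√(l / μ) - 1) / √(l / μ) = 1 - 1 / √(l / μ) := by field_simp
  have hr : 0 ≤ (1 - 1 / √(l / μ)) ^ (2 * numUpdates p W) := (even_two_mul _).pow_nonneg _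
  rw [Problem.regretRHTM, hJ, hρ]
  refine (sub_le_sub_left hopt _).trans (hsub.trans ?_)
  calc _ ≤ 5 * (l / μ) ^ 2 * (1 - 1 / √(l / μ)) ^ (2 * numUpdates p W) *
        (a ^ 2 * ((2 * controllabilityIndex p + 1) ^ 2 * (2 * θbar) * pathVariation N θ)
          / (2 * ν)) := by
        refine mul_le_mul_of_nonneg_left (hinit.trans ?_) (by positivity)
        exact div_le_div_of_nonneg_right hgrad (by positivity)
    _ = _ := by ring
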